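/- Setting. Let \(\langle A,B\rangle\) be the symmetric bilinear form on \(M_2(\mathbb C)\) obtained by polarising \(\det\) (real on Hermitian matrices), and let \(H^3\) be the set of Hermitian \(Q\in M_2(\mathbb C)\) with \(\det Q=1\) and \(\tfrac12\operatorname{tr}Q\ge 1\): hyperbolic 3-space, with metric \(-\langle\cdot,\cdot\rangle\), so that \(\cosh d(q_1,q_2)=\langle q_1,q_2\rangle\). Let \(m_1,m_2>0\), let \(V\) be a real potential that is differentiable on \((1,\infty)\), and put \(f=V'\). The 2-body problem is the Hamiltonian system on \(T^*H^3\times T^*H^3\) (collisions \(q_1=q_2\) removed) with Hamiltonian \(\frac{|p_1|^2}{2m_1}+\frac{|p_2|^2}{2m_2}+V(\cosh\psi)\), where \(\psi=d(q_1,q_2)\) is the separation. \(SL_2\mathbb C\) acts by \(g\cdot Q=gQg^\dagger\) (cotangent-lifted). A relative equilibrium (RE) is a solution contained in an \(SL_2\mathbb C\)-orbit; it is semisimple, respectively parabolic, if it is the orbit of a one-parameter subgroup \(t\mapsto\exp(t\xi)\) with \(\xi\in\mathfrak{sl}_2\mathbb C\) non-zero and semisimple, respectively conjugate to \(N=\begin{pmatrix}0&1\\0&0\end{pmatrix}\).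 Two motions are conjugate if some \(g\in SL_2\mathbb C\) carries one to the other. Write \(S_\eta=-i\eta I=\operatorname{diag}(\eta,-\eta)\), \(j=\begin{pmatrix}0&1\\1&0\end{pmatrix}\) and \(e^{\chi j}=\cosh\chi+j\sinh\chi\). Theorem. (1) Every semisimple RE is conjugate to an RE generated by \(S_\eta\) for some non-zero \(\eta\in\mathbb C\). (2) For every \(\psi>0\) there are unique positive reals \(\chi_1,\chi_2\) with \(\chi_1+\chi_2=\psi\) and \(m_1\sinh2\chi_1=m_2\sinh2\chi_2\); write \(\zeta\) for this common value. (3) Let \(\gamma\) be a semisimple RE at whose separation \(f(\cosh\psi)\ne0\). Then \(f(\cosh\psi)>0\), and there is a unique pair \((\theta,\psi)\) with \(\theta\in[0,\pi)\) (the phase) and \(\psi>0\) such that the bodies stay at distance \(\psi\) and \(\gamma\) is conjugate to an RE generated by some \(S_\eta\), \(\eta\neq0\), with \[\arg\eta=\theta,\qquad q_1(0)=e^{\chi_1j},\qquad q_2(0)=e^{-\chi_2j},\qquad |\eta|^2=\frac{f(\cosh\psi)\sinh\psi}{2\zeta},\] where \(\chi_1,\chi_2,\zeta\) are as in (2). Two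 such RE are conjugate if and only if they have the same \((\theta,\psi)\). (4) Conversely, for every \(\theta\in[0,\pi)\) and every \(\psi>0\) with \(f(\cosh\psi)>0\), there is a semisimple RE of the form displayed in (3). In particular, if the potential is strictly attractive (\(f(z)>0\) for all \(z>1\)), then the semisimple RE are classified up to conjugacy by all pairs \((\theta,\psi)\in[0,\pi)\times(0,\infty)\). (5) If the potential is strictly attractive, there are no parabolic RE. -/

import Mathlib

open Matrix Complex Set

noncomputable section

namespace TwoBodyH3

/-- The biquaternion algebra, represented as `M₂(ℂ)`. -/
abbrev Biq : Type := Matrix (Fin 2) (Fin 2) ℂ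

/-- The group `SL₂(ℂ)`. -/
abbrev SL2C : Type := Matrix.SpecialLinearGroup (Fin 2) ℂ

/-- The biquaternion unit `I`. -/
def unitI : Biq := !![Complex.I, 0; 0, -Complex.I]

/-- The biquaternion unit `K`. -/
def unitK : Biq := !![0, Complex.I; Complex.I, 0]

/-- The split-complex unit `j = -iK`, with `j² = 1`. -/
def unitj : Biq := (-Complex.I) • unitK

/-- `e^{χ j} = cosh χ + j sinh χ`. -/
def splitExp (χ : ℝ) : Biq := (Real.cosh χ : ℂ) • (1 : Biq) + (Real.sinh χ : ℂ) • unitj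

/-- The element `S = -iηI = diag(η, -η)` of `sl₂(ℂ)`. -/
def genS (η : ℂ) : Biq := (-(Complex.I * η)) • unitI

/-- The nilpotent element `N`. -/
def genN : Biq := !![0, 1; 0, 0]

/-- The symmetric bilinear form `⟨A, B⟩` obtained by polarising the determinant. On Hermitian
matrices it is real, and is the Minkowski form of signature `(1, 3)`. -/
def form (A B : Biq) : ℝ := ((A + B).det - A.det - B.det).re / 2

/-- Hyperbolic 3-space: Hermitian matrices with unit determinant, in the component `t ≥ 1`,
where `t` is half of the trace. -/
def H3 : Set Biq := {Q | Q.IsHermitian ∧ Q.det = 1 ∧ 1 ≤ Q.trace.re / 2}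

/-- Hyperbolic distance between two points of `H3`: `⟨q₁, q₂⟩ = cosh (dist)`. -/
def hypDist (q₁ q₂ : Biq) : ℝ := Real.arcosh (form q₁ q₂)

/-- The ambient real vector space of the phase space; points are `((q₁, p₁), (q₂, p₂))`. -/
abbrev Ambient : Type := (Biq × Biq) × (Biq × Biq)

/-- `T*H³`: the covector `⟨p, ·⟩` at `q` is represented by the Hermitian matrix `p` with
`⟨q, p⟩ = 0`. -/
def cotangentH3 : Set (Biq × Biq) := {x | x.1 ∈ H3 ∧ x.2.IsHermitian ∧ form x.1 x.2 = 0}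

/-- The phase space `T*H³ × T*H³`, with the collision set removed. -/
def phaseSpace : Set Ambient :=
  {x | x.1 ∈ cotangentH3 ∧ x.2 ∈ cotangentH3 ∧ x.1.1 ≠ x.2.1}

/-- The tangent space to `T*H³` at `(q, p)`, inside the ambient space. -/
def tangentCotangentH3 (x : Biq × Biq) : Set (Biq × Biq) :=
  {v | v.1.IsHermitian ∧ v.2.IsHermitian ∧ form x.1 v.1 = 0 ∧ form v.1 x.2 + form x.1 v.2 = 0}

/-- The tangent space to the phase space at `x`. -/
def tangentPhase (x : Ambient) : Set Ambient :=
  {v | v.1 ∈ tangentCotangentH3 x.1 ∧ v.2 ∈ tangentCotangentH3 x.2}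

/-- The canonical symplectic form `dq₁ ∧ dp₁ + dq₂ ∧ dp₂`. -/
def sympl (v w : Ambient) : ℝ :=
  (form v.1.1 w.1.2 - form v.1.2 w.1.1) + (form v.2.1 w.2.2 - form v.2.2 w.2.1)

/-- The Hamiltonian. The form `⟨·, ·⟩` is minus the Riemannian metric on the tangent spaces of
`H³`, so that `-⟨p, p⟩ = |p|²` and the kinetic energy is positive. -/
def hamiltonian (m₁ m₂ : ℝ) (V : ℝ → ℝ) (x : Ambient) : ℝ :=
  -(form x.1.2 x.1.2) / (2 * m₁) - form x.2.2 x.2.2 / (2 * m₂) + V (form x.1.1 x.2.1)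

/-- `γ` is a (complete) solution of the 2-body problem: it lies in the phase space and
`ω(γ', Y) = dH(Y)` for every vector `Y` tangent to the phase space along `γ`. -/
def IsSolution (m₁ m₂ : ℝ) (V : ℝ → ℝ) (γ : ℝ → Ambient) : Prop :=
  ∀ t, γ t ∈ phaseSpace ∧ ∃ X : Ambient, HasDerivAt γ X t ∧
    ∀ Y ∈ tangentPhase (γ t), sympl X Y = lineDeriv ℝ (hamiltonian m₁ m₂ V) (γ t) Y

/-- The (cotangent lift of the diagonal) action `g · Q = g Q g†`. -/
def act (g : Biq) (x : Ambient) : Ambient :=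
  ((g * x.1.1 * gᴴ, g * x.1.2 * gᴴ), (g * x.2.1 * gᴴ, g * x.2.2 * gᴴ))

/-- A relative equilibrium: a solution contained in an `SL₂(ℂ)`-orbit. -/
def IsRelEq (m₁ m₂ : ℝ) (V : ℝ → ℝ) (γ : ℝ → Ambient) : Prop :=
  IsSolution m₁ m₂ V γ ∧ ∀ t, ∃ g : SL2C, γ t = act (g : Biq) (γ 0)

/-- `γ` is the orbit of the one-parameter subgroup `t ↦ exp(tξ)`. -/
def GeneratedBy (ξ : Biq) (γ : ℝ → Ambient) : Prop :=
  ∀ t : ℝ, γ t = act (NormedSpace.exp (t • ξ)) (γ 0)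

/-- A semisimple relative equilibrium: one generated by a non-zero semisimple element of
`sl₂(ℂ)`. -/
def IsSemisimpleRelEq (m₁ m₂ : ℝ) (V : ℝ → ℝ) (γ : ℝ → Ambient) : Prop :=
  IsRelEq m₁ m₂ V γ ∧ ∃ ξ : Biq, ξ ≠ 0 ∧ ξ.trace = 0 ∧
    Module.End.IsSemisimple (Matrix.toLin' ξ) ∧ GeneratedBy ξ γ

/-- A parabolic relative equilibrium: one generated by an element conjugate to `N`. -/
def IsParabolicRelEq (m₁ m₂ : ℝ) (V : ℝ → ℝ) (γ : ℝ → Ambient) : Prop :=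
  IsRelEq m₁ m₂ V γ ∧ ∃ g : SL2C,
    GeneratedBy ((g : Biq) * genN * ((g⁻¹ : SL2C) : Biq)) γ

/-- Two motions are conjugate if an element of `SL₂(ℂ)` carries one to the other. -/
def Conjugate (γ γ' : ℝ → Ambient) : Prop :=
  ∃ g : SL2C, ∀ t, γ' t = act (g : Biq) (γ t)

/-- `γ` is a relative equilibrium in standard position, of phase `θ` and separation `ψ`. -/
def IsStandardRelEq (m₁ m₂ : ℝ) (V : ℝ → ℝ) (θ ψ : ℝ) (γ : ℝ → Ambient) : Prop :=
  IsRelEq m₁ m₂ V γ ∧ ∃ (η : ℂ) (χ₁ χ₂ : ℝ),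
    η ≠ 0 ∧ η.arg = θ ∧ GeneratedBy (genS η) γ ∧
    0 < χ₁ ∧ 0 < χ₂ ∧ χ₁ + χ₂ = ψ ∧
    m₁ * Real.sinh (2 * χ₁) = m₂ * Real.sinh (2 * χ₂) ∧
    (γ 0).1.1 = splitExp χ₁ ∧ (γ 0).2.1 = splitExp (-χ₂) ∧
    ‖η‖ ^ 2 = deriv V (Real.cosh ψ) * Real.sinh ψ / (2 * (m₁ * Real.sinh (2 * χ₁)))

/-- `γ` has phase `θ ∈ [0, π)` and separation `ψ > 0`: its bodies stay at hyperbolic distance `ψ`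
and it is conjugate to a relative equilibrium in standard position with these parameters. -/
def HasPhaseSeparation (m₁ m₂ : ℝ) (V : ℝ → ℝ) (θ ψ : ℝ) (γ : ℝ → Ambient) : Prop :=
  θ ∈ Ico 0 Real.pi ∧ 0 < ψ ∧ (∀ t, hypDist (γ t).1.1 (γ t).2.1 = ψ) ∧
    ∃ γ', Conjugate γ γ' ∧ IsStandardRelEq m₁ m₂ V θ ψ γ'

/-- A potential `V = V(cosh ψ)` is strictly attractive if `V' > 0` at every `z = cosh ψ > 1`. -/
def StrictlyAttractive (V : ℝ → ℝ) : Prop := ∀ z : ℝ, 1 < z → 0 < deriv V z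

end TwoBodyH3

end

open TwoBodyH3

namespace TwoBodyH3

/-! ### The Minkowski form -/

/-! Nondegeneracy of the symplectic form turns the definition of a solution into an ODE for an
explicit field `hamField` (`isSolution_iff`). This field is equivariant, so for generators whose
exponentials have determinant 1 the motion `exp(tξ)·x` is a solution as soon as one algebraic
equation, `infAct ξ x = hamField x`, holds at time 0. Its first components give the momenta. What
remains is `m ξ·(ξ·q) = f q' + c q` for each body, with `c` a free multiplier coming from the
constraint `⟨q,q⟩ = 1` (`accel_of_infAct_eq`, `momentum_eq`).

A semisimple generator can be diagonalised to `S_η`. Applying `S_η` twice multiplies diagonal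
entries by `4(Re η)²` and off-diagonal entries by `-4(Im η)²`. If `f ≠ 0`, eliminating `c` within
each of these blocks aligns the two bodies, and a diagonal matrix, which commutes with `S_η`,
carries both to the geodesic `e^{χj}` (`exists_conj_eq_splitExp`). Eliminating `c` between the
blocks then leaves `2m₁|η|² sinh 2χ₁ = f sinh ψ = 2m₂|η|² sinh 2χ₂` (`accel_splitExp_iff`). This
contains the balance condition, the sign of `f` and the value of `|η|`, and leaves `arg η` free.

The unit `K` conjugates `S_η` to `S_{-η}`, so the phase can be taken in `[0, π)`. It cannot be
reduced further: the determinant of the total momentum is a conjugacy invariant, and at fixed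
separation it determines `η` up to sign (`momentDet_eq`). Conversely, phase and separation fix the
whole standard motion (`IsStandardRelEq.unique`). In the parabolic case the two equations of motion,
with multipliers eliminated, add up to a positive quantity equal to zero. -/

theorem form_eq (A B : Biq) :
    form A B = (A 0 0 * B 1 1 + A 1 1 * B 0 0 - A 0 1 * B 1 0 - A 1 0 * B 0 1).re / 2 := by
  simp only [form, Matrix.det_fin_two, Matrix.add_apply]
  congr 2
  ring

theorem form_comm (A B : Biq) : form A B = form B A := by
  simp only [form_eq]
  congr 2
  ring

theorem form_add_left (A B C : Biq) : form (A + B) C = form A C + form B C := by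
  simp only [form_eq, Matrix.add_apply, ← add_div, ← Complex.add_re]
  congr 2
  ring

theorem form_smul_left (r : ℝ) (A B : Biq) : form (r • A) B = r * form A B := by
  simp only [form_eq, Matrix.smul_apply, Complex.real_smul, ← mul_div_assoc,
    ← Complex.re_ofReal_mul]
  congr 2
  ring

theorem form_add_right (A B C : Biq) : form A (B + C) = form A B + form A C := by
  rw [form_comm, form_add_left, form_comm B, form_comm C]

theorem form_smul_right (r : ℝ) (A B : Biq) : form A (r • B) = r * form A B := by
  rw [form_comm, form_smul_left, form_comm]

theorem form_neg_left (A B : Biq) : form (-A) B = -form A B := by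
  rw [← neg_one_smul ℝ A, form_smul_left]; ring

theorem form_sub_left (A B C : Biq) : form (A - B) C = form A C - form B C := by
  rw [sub_eq_add_neg, form_add_left, form_neg_left]; ring

theorem form_sub_right (A B C : Biq) : form A (B - C) = form A B - form A C := by
  rw [form_comm, form_sub_left, form_comm B, form_comm C]

theorem form_self (A : Biq) : form A A = A.det.re := by
  simp only [form_eq, Matrix.det_fin_two, Complex.sub_re, Complex.add_re, Complex.mul_re]
  ring

theorem form_zero_left (A : Biq) : form 0 A = 0 := by simp [form_eq]

theorem form_zero_right (A : Biq) : form A 0 = 0 := by simp [form_eq]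

theorem isHermitian_two_iff {A : Biq} :
    A.IsHermitian ↔ (A 0 0).im = 0 ∧ (A 1 1).im = 0 ∧ (A 1 0).re = (A 0 1).re ∧
      (A 1 0).im = -(A 0 1).im := by
  constructor
  · intro h
    have h00 := congrArg Complex.im (h.apply 0 0)
    have h11 := congrArg Complex.im (h.apply 1 1)
    have h01 := h.apply 1 0
    simp only [Complex.star_def, Complex.conj_im] at h00 h11
    refine ⟨by linarith, by linarith, ?_, ?_⟩ <;> rw [← h01] <;> simp
  · rintro ⟨h0, h1, h2, h3⟩
    ext i j
    fin_cases i <;> fin_cases j <;>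
      simp [Matrix.conjTranspose_apply, Complex.ext_iff, h0, h1, h2, h3]

theorem isHermitian_real_smul {A : Biq} (h : A.IsHermitian) (r : ℝ) : (r • A).IsHermitian := by
  rw [isHermitian_two_iff] at *
  simpa [h.2.2.1] using ⟨Or.inr h.1, Or.inr h.2.1, by rw [h.2.2.2]; ring⟩

/-- The form in real coordinates on Hermitian matrices. -/
theorem form_eq_of_isHermitian {A B : Biq} (hA : A.IsHermitian) (hB : B.IsHermitian) :
    form A B = ((A 0 0).re * (B 1 1).re + (A 1 1).re * (B 0 0).re) / 2 -
      ((A 0 1).re * (B 0 1).re + (A 0 1).im * (B 0 1).im) := by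
  rw [isHermitian_two_iff] at hA hB
  obtain ⟨a1, a2, a3, a4⟩ := hA
  obtain ⟨b1, b2, b3, b4⟩ := hB
  simp only [form_eq, Complex.sub_re, Complex.add_re, Complex.mul_re, a1, a2, a3, a4, b1, b2, b3,
    b4]
  ring

theorem eq_of_isHermitian {A B : Biq} (hA : A.IsHermitian) (hB : B.IsHermitian)
    (h0 : (A 0 0).re = (B 0 0).re) (h1 : (A 1 1).re = (B 1 1).re)
    (h2 : (A 0 1).re = (B 0 1).re) (h3 : (A 0 1).im = (B 0 1).im) : A = B := by
  rw [isHermitian_two_iff] at hA hB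
  obtain ⟨a1, a2, a3, a4⟩ := hA
  obtain ⟨b1, b2, b3, b4⟩ := hB
  ext i j
  fin_cases i <;> fin_cases j <;> simp [Complex.ext_iff, *]

/-- The form is nondegenerate on Hermitian matrices. -/
theorem eq_zero_of_form_eq_zero {A : Biq} (hA : A.IsHermitian)
    (h : ∀ B : Biq, B.IsHermitian → form A B = 0) : A = 0 := by
  have e (a d : ℝ) (b : ℂ) : (!![(a : ℂ), b; star b, (d : ℂ)] : Biq).IsHermitian := by
    rw [isHermitian_two_iff]; simp
  have k (a d : ℝ) (b : ℂ) := form_eq_of_isHermitian hA (e a d b)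
  -- These four test matrices are a real basis of the Hermitian matrices.
  have k1 := k 1 0 0
  have k2 := k 0 1 0
  have k3 := k 0 0 1
  have k4 := k 0 0 Complex.I
  rw [h _ (e _ _ _)] at k1 k2 k3 k4
  simp at k1 k2 k3 k4
  exact eq_of_isHermitian hA Matrix.isHermitian_zero (by simp; linarith) (by simp; linarith)
    (by simpa using k3) (by simpa using k4)

/-- A Hermitian matrix orthogonal to the orthogonal complement of a unit vector `q` is a multiple
of `q`. -/
theorem eq_smul_of_form_eq_zero {q A : Biq} (hq : q.IsHermitian) (hqq : form q q = 1)
    (hA : A.IsHermitian) (h : ∀ B : Biq, B.IsHermitian → form q B = 0 → form A B = 0) :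
    A = form A q • q := by
  rw [← sub_eq_zero]
  refine eq_zero_of_form_eq_zero (hA.sub (isHermitian_real_smul hq _)) fun B hB => ?_
  -- The hypothesis is applied to the component of `B` orthogonal to `q`.
  have := h (B - form q B • q) (hB.sub (isHermitian_real_smul hq _))
    (by rw [form_sub_right, form_smul_right, hqq]; ring)
  rw [form_sub_right, form_smul_right] at this
  rw [form_sub_left, form_smul_left]
  linarith

/-! ### Hyperbolic space -/

theorem form_self_of_mem_H3 {q : Biq} (hq : q ∈ H3) : form q q = 1 := by
  rw [form_self, hq.2.1, Complex.one_re]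

/-- The product of the diagonal entries is at least 1, so they have the same sign, and the trace
selects the positive one. Conversely, AM-GM recovers the trace bound. This form is convenient for
real arithmetic. -/
theorem mem_H3_iff {q : Biq} :
    q ∈ H3 ↔ q.IsHermitian ∧ 0 < (q 0 0).re ∧ 0 < (q 1 1).re ∧
      (q 0 0).re * (q 1 1).re = 1 + (q 0 1).re ^ 2 + (q 0 1).im ^ 2 := by
  constructor
  · intro hq
    have h1 := form_self_of_mem_H3 hq
    rw [form_eq_of_isHermitian hq.1 hq.1] at h1
    have h2 : 1 ≤ (q 0 0 + q 1 1).re / 2 := by simpa [Matrix.trace_fin_two] using hq.2.2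
    rw [Complex.add_re] at h2
    have h3 : 0 < (q 0 0).re * (q 1 1).re := by
      nlinarith [sq_nonneg (q 0 1).re, sq_nonneg (q 0 1).im]
    have h4 : 0 < (q 0 0).re := by
      by_contra! h
      nlinarith
    exact ⟨hq.1, h4, by nlinarith, by linarith⟩
  · rintro ⟨hq, h0, h1, h2⟩
    obtain ⟨a1, a2, a3, a4⟩ := isHermitian_two_iff.1 hq
    refine ⟨hq, ?_, ?_⟩
    · apply Complex.ext <;>
      simp only [Matrix.det_fin_two, Complex.sub_re, Complex.sub_im, Complex.mul_re,
        Complex.mul_im, a1, a2, a3, a4, Complex.one_re, Complex.one_im] <;> linarith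
    · rw [Matrix.trace_fin_two, Complex.add_re]
      nlinarith [sq_nonneg ((q 0 0).re - (q 1 1).re), sq_nonneg (q 0 1).re,
        sq_nonneg (q 0 1).im]

/-- The reversed Cauchy–Schwarz inequality. -/
theorem one_lt_form {q q' : Biq} (hq : q ∈ H3) (hq' : q' ∈ H3) (hne : q ≠ q') :
    1 < form q q' := by
  obtain ⟨h, h0, h1, h2⟩ := mem_H3_iff.1 hq
  obtain ⟨k, k0, k1, k2⟩ := mem_H3_iff.1 hq'
  rw [form_eq_of_isHermitian h k]
  by_contra! hle
  apply hne
  set a := (q 0 0).re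
  set d := (q 1 1).re
  set b := (q 0 1).re
  set c := (q 0 1).im
  set a' := (q' 0 0).re
  set d' := (q' 1 1).re
  set b' := (q' 0 1).re
  set c' := (q' 0 1).im
  -- Clearing `d` and `d'` by the two determinant equations exhibits `⟨q,q'⟩ - 1` as a sum of
  -- squares over `2aa'`; if it is not positive, every square vanishes.
  have key : 2 * (a * a') * ((a * d' + d * a') / 2 - (b * b' + c * c') - 1) =
      (a - a') ^ 2 + (a * b' - a' * b) ^ 2 + (a * c' - a' * c) ^ 2 := by
    linear_combination a ^ 2 * k2 + a' ^ 2 * h2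
  have hpos : 0 < a * a' := mul_pos h0 k0
  have hz : (a - a') ^ 2 + (a * b' - a' * b) ^ 2 + (a * c' - a' * c) ^ 2 ≤ 0 := by
    rw [← key]
    exact mul_nonpos_of_nonneg_of_nonpos (by positivity) (by linarith)
  have e0 : a = a' := by nlinarith [sq_nonneg (a * b' - a' * b), sq_nonneg (a * c' - a' * c)]
  have e1 : a * b' - a' * b = 0 := by
    nlinarith [sq_nonneg (a - a'), sq_nonneg (a * c' - a' * c)]
  have e2 : a * c' - a' * c = 0 := by
    nlinarith [sq_nonneg (a - a'), sq_nonneg (a * b' - a' * b)]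
  rw [← e0] at e1 e2 k2
  have f1 : b = b' := mul_left_cancel₀ h0.ne' (by linarith)
  have f2 : c = c' := mul_left_cancel₀ h0.ne' (by linarith)
  rw [← f1, ← f2, ← h2] at k2
  exact eq_of_isHermitian h k e0 (mul_left_cancel₀ h0.ne' k2.symm) f1 f2

/-! ### The action of `SL₂(ℂ)` -/

theorem isHermitian_conj {A : Biq} (g : Biq) (hA : A.IsHermitian) : (g * A * gᴴ).IsHermitian :=
  Matrix.isHermitian_mul_mul_conjTranspose g hA

theorem det_conj {g : Biq} (hg : g.det = 1) (A : Biq) : (g * A * gᴴ).det = A.det := by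
  simp [Matrix.det_mul, Matrix.det_conjTranspose, hg]

theorem form_conj {g : Biq} (hg : g.det = 1) (A B : Biq) :
    form (g * A * gᴴ) (g * B * gᴴ) = form A B := by
  rw [form, ← Matrix.add_mul, ← Matrix.mul_add, det_conj hg, det_conj hg, det_conj hg, form]

theorem conj_mem_H3 {g q : Biq} (hg : g.det = 1) (hq : q ∈ H3) : g * q * gᴴ ∈ H3 := by
  obtain ⟨h, h0, h1, h2⟩ := mem_H3_iff.1 hq
  obtain ⟨a1, a2, a3, a4⟩ := isHermitian_two_iff.1 h
  have hH := isHermitian_conj g h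
  have hdet : (g * q * gᴴ).det = 1 := by rw [det_conj hg, hq.2.1]
  have hself : form (g * q * gᴴ) (g * q * gᴴ) = 1 := by rw [form_self, hdet, Complex.one_re]
  rw [form_eq_of_isHermitian hH hH] at hself
  -- The determinant is preserved, so only the choice of sheet is at stake; completing the square
  -- makes the new corner entry nonnegative.
  have hentry : (q 0 0).re * ((g * q * gᴴ) 0 0).re =
      ((q 0 0).re * (g 0 0).re + (q 0 1).re * (g 0 1).re + (q 0 1).im * (g 0 1).im) ^ 2 +
      ((q 0 0).re * (g 0 0).im + (q 0 1).re * (g 0 1).im - (q 0 1).im * (g 0 1).re) ^ 2 +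
      ((g 0 1).re ^ 2 + (g 0 1).im ^ 2) := by
    simp only [Matrix.mul_apply, Fin.sum_univ_two, Matrix.conjTranspose_apply, Complex.star_def,
      Complex.add_re, Complex.mul_re, Complex.add_im, Complex.mul_im, Complex.conj_re,
      Complex.conj_im, a1, a2, a3, a4]
    linear_combination ((g 0 1).re ^ 2 + (g 0 1).im ^ 2) * h2
  have hnn : 0 ≤ ((g * q * gᴴ) 0 0).re := by
    refine nonneg_of_mul_nonneg_right ?_ h0
    rw [hentry]; positivity
  have hprod : 0 < ((g * q * gᴴ) 0 0).re * ((g * q * gᴴ) 1 1).re := by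
    nlinarith [sq_nonneg ((g * q * gᴴ) 0 1).re, sq_nonneg ((g * q * gᴴ) 0 1).im]
  have hpos : 0 < ((g * q * gᴴ) 0 0).re :=
    lt_of_le_of_ne hnn fun e => by rw [← e, zero_mul] at hprod; exact hprod.false
  exact mem_H3_iff.2 ⟨hH, hpos, pos_of_mul_pos_right hprod hnn, by linarith⟩

theorem conj_injective {g A B : Biq} (hg : g.det = 1) (h : g * A * gᴴ = g * B * gᴴ) : A = B := by
  have hu : IsUnit g := (Matrix.isUnit_iff_isUnit_det g).2 (by simp [hg])
  have hu' : IsUnit gᴴ :=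
    (Matrix.isUnit_iff_isUnit_det gᴴ).2 (by simp [Matrix.det_conjTranspose, hg])
  exact hu.mul_left_cancel (hu'.mul_right_cancel h)

theorem act_mem_phaseSpace {g : Biq} (hg : g.det = 1) {x : Ambient} (hx : x ∈ phaseSpace) :
    act g x ∈ phaseSpace := by
  obtain ⟨⟨h1, h2, h3⟩, ⟨h4, h5, h6⟩, h7⟩ := hx
  exact ⟨⟨conj_mem_H3 hg h1, isHermitian_conj g h2, (form_conj hg _ _).trans h3⟩,
    ⟨conj_mem_H3 hg h4, isHermitian_conj g h5, (form_conj hg _ _).trans h6⟩,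
    fun h => h7 (conj_injective hg h)⟩

theorem act_act (g h : Biq) (x : Ambient) : act g (act h x) = act (g * h) x := by
  simp only [act, Matrix.conjTranspose_mul, Matrix.mul_assoc]

theorem act_one (x : Ambient) : act 1 x = x := by simp [act]

/-! ### The equations of motion -/

/-- The Hamiltonian vector field of the 2-body problem. -/
noncomputable def hamField (m₁ m₂ : ℝ) (V : ℝ → ℝ) (x : Ambient) : Ambient :=
  ((-(1 / m₁) • x.1.2, (form x.1.2 x.1.2 / m₁ +
      deriv V (form x.1.1 x.2.1) * form x.1.1 x.2.1) • x.1.1 -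
      deriv V (form x.1.1 x.2.1) • x.2.1),
    (-(1 / m₂) • x.2.2, (form x.2.2 x.2.2 / m₂ +
      deriv V (form x.1.1 x.2.1) * form x.1.1 x.2.1) • x.2.1 -
      deriv V (form x.1.1 x.2.1) • x.1.1))

theorem hamField_act (m₁ m₂ : ℝ) (V : ℝ → ℝ) {g : Biq} (hg : g.det = 1) (x : Ambient) :
    hamField m₁ m₂ V (act g x) = act g (hamField m₁ m₂ V x) := by
  simp only [hamField, act, form_conj hg, Matrix.mul_sub, Matrix.sub_mul, Matrix.mul_smul,
    Matrix.smul_mul]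

theorem hamField_mem_tangentPhase {m₁ m₂ : ℝ} (V : ℝ → ℝ) {x : Ambient} (hx : x ∈ phaseSpace) :
    hamField m₁ m₂ V x ∈ tangentPhase x := by
  obtain ⟨⟨h1, h2, h3⟩, ⟨h4, h5, h6⟩, h7⟩ := hx
  have s1 := form_self_of_mem_H3 h1
  have s2 := form_self_of_mem_H3 h4
  refine ⟨⟨isHermitian_real_smul h2 _, (isHermitian_real_smul h1.1 _).sub
    (isHermitian_real_smul h4.1 _), ?_, ?_⟩, ⟨isHermitian_real_smul h5 _,
    (isHermitian_real_smul h4.1 _).sub (isHermitian_real_smul h1.1 _), ?_, ?_⟩⟩ <;>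
  simp only [hamField, form_smul_left, form_smul_right, form_sub_right, h3, h6, s1, s2,
    form_comm x.2.1 x.1.1] <;> ring

/-- The symplectic form is nondegenerate on each cotangent factor. -/
theorem eq_zero_of_sympl_eq_zero {x v : Biq × Biq} (hx : x ∈ cotangentH3)
    (hv : v ∈ tangentCotangentH3 x)
    (h : ∀ w ∈ tangentCotangentH3 x, form v.1 w.2 - form v.2 w.1 = 0) : v = 0 := by
  obtain ⟨h1, h2, h3⟩ := hx
  obtain ⟨k1, k2, k3, k4⟩ := hv
  have s := form_self_of_mem_H3 h1
  have e1 : v.1 = 0 := by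
    rw [eq_smul_of_form_eq_zero h1.1 s k1 fun B hB hqB => ?_, form_comm, k3, zero_smul]
    have := h (0, B) ⟨Matrix.isHermitian_zero, hB, form_zero_right _, by
      simp [form_zero_left, hqB]⟩
    simpa [form_zero_right] using this
  rw [e1, form_zero_left, zero_add] at k4
  have e2 : v.2 = 0 := by
    rw [eq_smul_of_form_eq_zero h1.1 s k2 fun B hB hqB => ?_, form_comm, k4, zero_smul]
    -- The multiple of `q` in the second slot corrects for the linearised constraint `⟨q,p⟩ = 0`, so
    -- that the test vector is tangent.
    have := h (B, (-form B x.2) • x.1) ⟨hB, isHermitian_real_smul h1.1 _, hqB, by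
      rw [form_smul_right, s]; ring⟩
    simpa [e1, form_zero_left] using this
  exact Prod.ext e1 e2

theorem sub_mem_tangentCotangentH3 {x v w : Biq × Biq} (hv : v ∈ tangentCotangentH3 x)
    (hw : w ∈ tangentCotangentH3 x) : v - w ∈ tangentCotangentH3 x := by
  obtain ⟨h1, h2, h3, h4⟩ := hv
  obtain ⟨k1, k2, k3, k4⟩ := hw
  refine ⟨h1.sub k1, h2.sub k2, ?_, ?_⟩ <;>
    simp only [Prod.fst_sub, Prod.snd_sub, form_sub_left, form_sub_right] <;> linarith

theorem zero_mem_tangentCotangentH3 (x : Biq × Biq) : 0 ∈ tangentCotangentH3 x :=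
  ⟨Matrix.isHermitian_zero, Matrix.isHermitian_zero, form_zero_right _, by
    simp [form_zero_left, form_zero_right]⟩

theorem eq_of_sympl_eq {x X Z : Ambient} (hx : x ∈ phaseSpace) (hX : X ∈ tangentPhase x)
    (hZ : Z ∈ tangentPhase x) (h : ∀ Y ∈ tangentPhase x, sympl X Y = sympl Z Y) : X = Z := by
  refine Prod.ext (sub_eq_zero.1 ?_) (sub_eq_zero.1 ?_)
  · refine eq_zero_of_sympl_eq_zero hx.1 (sub_mem_tangentCotangentH3 hX.1 hZ.1) fun w hw => ?_
    have := h (w, 0) ⟨hw, zero_mem_tangentCotangentH3 _⟩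
    simp [sympl, form_zero_right] at this
    simp only [Prod.fst_sub, Prod.snd_sub, form_sub_left]
    linarith
  · refine eq_zero_of_sympl_eq_zero hx.2.1 (sub_mem_tangentCotangentH3 hX.2 hZ.2) fun w hw => ?_
    have := h (0, w) ⟨zero_mem_tangentCotangentH3 _, hw⟩
    simp [sympl, form_zero_right] at this
    simp only [Prod.fst_sub, Prod.snd_sub, form_sub_left]
    linarith

theorem hasDerivAt_form_line (A A' B B' : Biq) :
    HasDerivAt (fun s : ℝ => form (A + s • A') (B + s • B')) (form A' B + form A B') 0 := by
  have h : HasDerivAt (fun s : ℝ => form A B + s * (form A' B + form A B') + s * s * form A' B')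
      (form A' B + form A B') 0 := by
    have h1 := hasDerivAt_id (0 : ℝ)
    refine (((h1.mul_const (form A' B + form A B')).const_add (form A B)).add
      ((h1.mul h1).mul_const (form A' B'))).congr_deriv ?_
    simp
  refine h.congr_of_eventuallyEq (Filter.Eventually.of_forall fun s => ?_)
  simp only [form_add_left, form_add_right, form_smul_left, form_smul_right]
  ring

/-- Away from collisions `⟨q₁,q₂⟩ > 1`, which is where `V` is known to be differentiable. -/
theorem lineDeriv_hamiltonian {m₁ m₂ : ℝ} {V : ℝ → ℝ}
    (hV : DifferentiableOn ℝ V (Set.Ioi 1)) {x : Ambient} (hx : x ∈ phaseSpace) (Y : Ambient) :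
    lineDeriv ℝ (hamiltonian m₁ m₂ V) x Y =
      -(form x.1.2 Y.1.2 / m₁) - form x.2.2 Y.2.2 / m₂ +
        deriv V (form x.1.1 x.2.1) * (form Y.1.1 x.2.1 + form x.1.1 Y.2.1) := by
  have hlt := one_lt_form hx.1.1 hx.2.1.1 hx.2.2
  have hVd : HasDerivAt V (deriv V (form x.1.1 x.2.1))
      (form (x.1.1 + (0 : ℝ) • Y.1.1) (x.2.1 + (0 : ℝ) • Y.2.1)) := by
    simpa using (hV.differentiableAt (Ioi_mem_nhds hlt)).hasDerivAt
  have h := (((hasDerivAt_form_line x.1.2 Y.1.2 x.1.2 Y.1.2).neg.div_const (2 * m₁)).sub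
    ((hasDerivAt_form_line x.2.2 Y.2.2 x.2.2 Y.2.2).div_const (2 * m₂))).add
    (hVd.comp (0 : ℝ) (hasDerivAt_form_line x.1.1 Y.1.1 x.2.1 Y.2.1))
  have h' : HasLineDerivAt ℝ (hamiltonian m₁ m₂ V) _ x Y := h
  rw [h'.lineDeriv, form_comm Y.1.2, form_comm Y.2.2]
  ring

theorem sympl_hamField {m₁ m₂ : ℝ} {V : ℝ → ℝ}
    (hV : DifferentiableOn ℝ V (Set.Ioi 1)) {x : Ambient} (hx : x ∈ phaseSpace) {Y : Ambient}
    (hY : Y ∈ tangentPhase x) :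
    sympl (hamField m₁ m₂ V x) Y = lineDeriv ℝ (hamiltonian m₁ m₂ V) x Y := by
  rw [lineDeriv_hamiltonian hV hx]
  obtain ⟨⟨-, -, h1, h2⟩, ⟨-, -, h3, h4⟩⟩ := hY
  simp only [sympl, hamField, form_smul_left, form_sub_left, h1, h3, form_comm x.2.1 Y.1.1]
  ring

/-! ### Differentiating along curves -/

theorem hasDerivAt_ambient_iff {γ : ℝ → Ambient} {X : Ambient} {t : ℝ} :
    HasDerivAt γ X t ↔
      (HasDerivAt (fun s => (γ s).1.1) X.1.1 t ∧ HasDerivAt (fun s => (γ s).1.2) X.1.2 t) ∧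
      (HasDerivAt (fun s => (γ s).2.1) X.2.1 t ∧ HasDerivAt (fun s => (γ s).2.2) X.2.2 t) := by
  -- The derivative depends only on the topology of the matrix space; a norm is chosen locally to
  -- give access to calculus in normed spaces.
  let : NormedRing Biq := Matrix.linftyOpNormedRing
  let : NormedAlgebra ℝ Biq := Matrix.linftyOpNormedAlgebra
  have key {E F : Type} [NormedAddCommGroup E] [NormedSpace ℝ E] [NormedAddCommGroup F]
      [NormedSpace ℝ F] (f : ℝ → E × F) (Z : E × F) : HasDerivAt f Z t ↔
      HasDerivAt (fun s => (f s).1) Z.1 t ∧ HasDerivAt (fun s => (f s).2) Z.2 t :=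
    ⟨fun h => ⟨(ContinuousLinearMap.fst ℝ E F).hasFDerivAt.comp_hasDerivAt t h,
      (ContinuousLinearMap.snd ℝ E F).hasFDerivAt.comp_hasDerivAt t h⟩,
      fun h => h.1.prodMk h.2⟩
  exact (key γ X).trans (and_congr (key (fun s => (γ s).1) X.1) (key (fun s => (γ s).2) X.2))

theorem hasDerivAt_entry {f : ℝ → Biq} {X : Biq} {t : ℝ} (h : HasDerivAt f X t) (i j : Fin 2) :
    HasDerivAt (fun s => f s i j) (X i j) t := by
  let : NormedRing Biq := Matrix.linftyOpNormedRing
  let : NormedAlgebra ℝ Biq := Matrix.linftyOpNormedAlgebra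
  exact hasDerivAt_pi.1 (hasDerivAt_pi.1 h i) j

theorem hasDerivAt_re {f : ℝ → ℂ} {z : ℂ} {t : ℝ} (h : HasDerivAt f z t) :
    HasDerivAt (fun s => (f s).re) z.re t :=
  Complex.reCLM.hasFDerivAt.comp_hasDerivAt t h

theorem hasDerivAt_form {f g : ℝ → Biq} {A B : Biq} {t : ℝ} (hf : HasDerivAt f A t)
    (hg : HasDerivAt g B t) :
    HasDerivAt (fun s => form (f s) (g s)) (form A (g t) + form (f t) B) t := by
  have F := hasDerivAt_entry hf
  have G := hasDerivAt_entry hg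
  have h : HasDerivAt (fun s => f s 0 0 * g s 1 1 + f s 1 1 * g s 0 0 - f s 0 1 * g s 1 0 -
      f s 1 0 * g s 0 1) _ t :=
    ((((F 0 0).mul (G 1 1)).add ((F 1 1).mul (G 0 0))).sub
      ((F 0 1).mul (G 1 0))).sub ((F 1 0).mul (G 0 1))
  have h' := (hasDerivAt_re h).div_const 2
  simp only [form_eq]
  refine h'.congr_deriv ?_
  rw [← add_div, ← Complex.add_re]
  congr 2
  ring

theorem isHermitian_of_hasDerivAt {f : ℝ → Biq} {X : Biq} {t : ℝ} (hf : HasDerivAt f X t)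
    (h : ∀ s, (f s).IsHermitian) : X.IsHermitian := by
  ext i j
  have h1 := (hasDerivAt_entry hf j i).star
  refine h1.unique ((hasDerivAt_entry hf i j).congr_of_eventuallyEq
    (Filter.Eventually.of_forall fun s => (h s).apply i j))

/-- Obtained by differentiating the constraints `⟨q,q⟩ = 1` and `⟨q,p⟩ = 0`. -/
theorem mem_tangentCotangentH3_of_hasDerivAt {q p : ℝ → Biq} {A B : Biq} {t : ℝ}
    (hq : HasDerivAt q A t) (hp : HasDerivAt p B t) (h : ∀ s, (q s, p s) ∈ cotangentH3) :
    (A, B) ∈ tangentCotangentH3 (q t, p t) := by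
  refine ⟨isHermitian_of_hasDerivAt hq fun s => (h s).1.1,
    isHermitian_of_hasDerivAt hp fun s => (h s).2.1, ?_, ?_⟩
  · have h1 := (hasDerivAt_form hq hq).unique ((hasDerivAt_const t (1 : ℝ)).congr_of_eventuallyEq
      (Filter.Eventually.of_forall fun s => form_self_of_mem_H3 (h s).1))
    rw [form_comm A] at h1
    simp only
    linarith
  · exact (hasDerivAt_form hq hp).unique ((hasDerivAt_const t (0 : ℝ)).congr_of_eventuallyEq
      (Filter.Eventually.of_forall fun s => (h s).2.2))

/-- The solutions of the 2-body problem are the integral curves of `hamField`. -/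
theorem isSolution_iff {m₁ m₂ : ℝ} {V : ℝ → ℝ} (hV : DifferentiableOn ℝ V (Set.Ioi 1))
    {γ : ℝ → Ambient} : IsSolution m₁ m₂ V γ ↔
      ∀ t, γ t ∈ phaseSpace ∧ HasDerivAt γ (hamField m₁ m₂ V (γ t)) t := by
  constructor
  · intro h t
    obtain ⟨hx, X, hX, hXY⟩ := h t
    refine ⟨hx, ?_⟩
    obtain ⟨⟨d1, d2⟩, d3, d4⟩ := hasDerivAt_ambient_iff.1 hX
    -- The velocity is tested only against tangent vectors, so nondegeneracy identifies it only once
    -- it is itself known to be tangent.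
    have t1 : (X.1.1, X.1.2) ∈ tangentCotangentH3 ((γ t).1.1, (γ t).1.2) :=
      mem_tangentCotangentH3_of_hasDerivAt (q := fun s => (γ s).1.1) (p := fun s => (γ s).1.2)
        d1 d2 fun s => (h s).1.1
    have t2 : (X.2.1, X.2.2) ∈ tangentCotangentH3 ((γ t).2.1, (γ t).2.2) :=
      mem_tangentCotangentH3_of_hasDerivAt (q := fun s => (γ s).2.1) (p := fun s => (γ s).2.2)
        d3 d4 fun s => (h s).1.2.1
    have e : X = hamField m₁ m₂ V (γ t) :=
      eq_of_sympl_eq hx ⟨t1, t2⟩ (hamField_mem_tangentPhase V hx)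
        fun Y hY => (hXY Y hY).trans (sympl_hamField hV hx hY).symm
    exact e ▸ hX
  · intro h t
    exact ⟨(h t).1, _, (h t).2, fun Y hY => sympl_hamField hV (h t).1 hY⟩

/-! ### Motions generated by one-parameter subgroups -/

/-- The infinitesimal action of `ξ` on matrices. -/
def infConj (ξ A : Biq) : Biq := ξ * A + A * ξᴴ

/-- The infinitesimal action of `ξ` on the ambient space. -/
def infAct (ξ : Biq) (x : Ambient) : Ambient :=
  ((infConj ξ x.1.1, infConj ξ x.1.2), (infConj ξ x.2.1, infConj ξ x.2.2))

theorem infConj_real_smul (ξ A : Biq) (r : ℝ) : infConj ξ (r • A) = r • infConj ξ A := by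
  simp [infConj]

theorem isHermitian_infConj (ξ : Biq) {A : Biq} (hA : A.IsHermitian) :
    (infConj ξ A).IsHermitian := by
  rw [Matrix.IsHermitian, infConj, Matrix.conjTranspose_add, Matrix.conjTranspose_mul,
    Matrix.conjTranspose_mul, Matrix.conjTranspose_conjTranspose, hA.eq, add_comm]

/-- The infinitesimal version of the invariance of the form under `SL₂(ℂ)`. -/
theorem form_infConj {ξ : Biq} (hξ : ξ.trace = 0) (A B : Biq) :
    form (infConj ξ A) B + form A (infConj ξ B) = 0 := by
  have h : ξ 1 1 = -ξ 0 0 := by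
    rw [Matrix.trace_fin_two] at hξ
    linear_combination hξ
  rw [form_eq, form_eq, ← add_div, ← Complex.add_re]
  simp only [infConj, Matrix.add_apply, Matrix.mul_apply, Fin.sum_univ_two,
    Matrix.conjTranspose_apply, h, star_neg]
  ring_nf
  simp

theorem hasDerivAt_exp_conj (ξ A : Biq) (t : ℝ) :
    HasDerivAt (fun s : ℝ => NormedSpace.exp (s • ξ) * A * (NormedSpace.exp (s • ξ))ᴴ)
      (infConj ξ (NormedSpace.exp (t • ξ) * A * (NormedSpace.exp (t • ξ))ᴴ)) t := by
  let : NormedRing Biq := Matrix.linftyOpNormedRing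
  let : NormedAlgebra ℝ Biq := Matrix.linftyOpNormedAlgebra
  have e (s : ℝ) : (NormedSpace.exp (s • ξ))ᴴ = NormedSpace.exp (s • ξᴴ) := by
    rw [← Matrix.exp_conjTranspose, Matrix.conjTranspose_smul, star_trivial]
  simp only [e]
  refine (((hasDerivAt_exp_smul_const' ξ t).mul_const A).mul
    (hasDerivAt_exp_smul_const ξᴴ t)).congr_deriv ?_
  simp only [infConj, Matrix.mul_assoc]
  rfl

theorem GeneratedBy.hasDerivAt {ξ : Biq} {γ : ℝ → Ambient} (h : GeneratedBy ξ γ) (t : ℝ) :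
    HasDerivAt γ (infAct ξ (γ t)) t := by
  have e : γ = fun s => act (NormedSpace.exp (s • ξ)) (γ 0) := funext h
  rw [h t, e]
  simp only [hasDerivAt_ambient_iff]
  simpa only [act, infAct, zero_smul, NormedSpace.exp_zero, Matrix.one_mul,
    Matrix.conjTranspose_one, Matrix.mul_one] using
    ⟨⟨hasDerivAt_exp_conj ξ _ t, hasDerivAt_exp_conj ξ _ t⟩, hasDerivAt_exp_conj ξ _ t,
      hasDerivAt_exp_conj ξ _ t⟩

theorem infAct_act {ξ g : Biq} (h : ξ * g = g * ξ) (x : Ambient) :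
    infAct ξ (act g x) = act g (infAct ξ x) := by
  have h' : gᴴ * ξᴴ = ξᴴ * gᴴ := by
    rw [← Matrix.conjTranspose_mul, h, Matrix.conjTranspose_mul]
  have k (A : Biq) : infConj ξ (g * A * gᴴ) = g * infConj ξ A * gᴴ := by
    rw [infConj, infConj, Matrix.mul_add, Matrix.add_mul, Matrix.mul_assoc (g * A), h',
      ← Matrix.mul_assoc, ← Matrix.mul_assoc, h]
    simp only [Matrix.mul_assoc]
  simp only [infAct, act, k]

theorem commute_exp_smul (ξ : Biq) (t : ℝ) :
    ξ * NormedSpace.exp (t • ξ) = NormedSpace.exp (t • ξ) * ξ := by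
  let : NormedRing Biq := Matrix.linftyOpNormedRing
  let : NormedAlgebra ℝ Biq := Matrix.linftyOpNormedAlgebra
  exact (hasDerivAt_exp_smul_const' ξ t).unique (hasDerivAt_exp_smul_const ξ t)

theorem IsSolution.infAct_eq {m₁ m₂ : ℝ} {V : ℝ → ℝ} (hV : DifferentiableOn ℝ V (Set.Ioi 1))
    {ξ : Biq} {γ : ℝ → Ambient} (hγ : IsSolution m₁ m₂ V γ) (h : GeneratedBy ξ γ) :
    infAct ξ (γ 0) = hamField m₁ m₂ V (γ 0) := by
  let : NormedRing Biq := Matrix.linftyOpNormedRing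
  let : NormedAlgebra ℝ Biq := Matrix.linftyOpNormedAlgebra
  exact (h.hasDerivAt 0).unique ((isSolution_iff hV).1 hγ 0).2

/-- Both fields commute with the action of `exp(tξ)`, the first because `ξ` commutes with its
exponential, so equality at time 0 is carried along the whole orbit. -/
theorem isRelEq_of_infAct_eq {m₁ m₂ : ℝ} {V : ℝ → ℝ} (hV : DifferentiableOn ℝ V (Set.Ioi 1))
    {ξ : Biq} (hdet : ∀ t : ℝ, (NormedSpace.exp (t • ξ)).det = 1) {γ : ℝ → Ambient}
    (h : GeneratedBy ξ γ) (h0 : γ 0 ∈ phaseSpace) (he : infAct ξ (γ 0) = hamField m₁ m₂ V (γ 0)) :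
    IsRelEq m₁ m₂ V γ := by
  refine ⟨(isSolution_iff hV).2 fun t => ⟨?_, ?_⟩, fun t => ⟨⟨_, hdet t⟩, h t⟩⟩
  · rw [h t]
    exact act_mem_phaseSpace (hdet t) h0
  · have := h.hasDerivAt t
    rwa [h t, infAct_act (commute_exp_smul ξ t), he, ← hamField_act _ _ _ (hdet t), ← h t] at this

/-! ### Conjugation -/

theorem coe_mul_coe_inv (g : SL2C) : (g : Biq) * ((g⁻¹ : SL2C) : Biq) = 1 := by
  rw [← Matrix.SpecialLinearGroup.coe_mul, mul_inv_cancel, Matrix.SpecialLinearGroup.coe_one]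

theorem coe_inv_mul_coe (g : SL2C) : ((g⁻¹ : SL2C) : Biq) * (g : Biq) = 1 := by
  rw [← Matrix.SpecialLinearGroup.coe_mul, inv_mul_cancel, Matrix.SpecialLinearGroup.coe_one]

theorem Conjugate.symm {γ γ' : ℝ → Ambient} : Conjugate γ γ' → Conjugate γ' γ := by
  rintro ⟨g, hg⟩
  refine ⟨g⁻¹, fun t => ?_⟩
  rw [hg, act_act, coe_inv_mul_coe, act_one]

theorem Conjugate.trans {γ γ' γ'' : ℝ → Ambient} :
    Conjugate γ γ' → Conjugate γ' γ'' → Conjugate γ γ'' := by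
  rintro ⟨g, hg⟩ ⟨h, hh⟩
  refine ⟨h * g, fun t => ?_⟩
  rw [hh, hg, act_act, Matrix.SpecialLinearGroup.coe_mul]

theorem Conjugate.form_eq {γ γ' : ℝ → Ambient} (h : Conjugate γ γ') (t : ℝ) :
    form (γ' t).1.1 (γ' t).2.1 = form (γ t).1.1 (γ t).2.1 := by
  obtain ⟨g, hg⟩ := h
  rw [hg]
  exact form_conj g.2 _ _

theorem IsRelEq.form_eq {m₁ m₂ : ℝ} {V : ℝ → ℝ} {γ : ℝ → Ambient} (h : IsRelEq m₁ m₂ V γ)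
    (t : ℝ) : form (γ t).1.1 (γ t).2.1 = form (γ 0).1.1 (γ 0).2.1 := by
  obtain ⟨g, hg⟩ := h.2 t
  rw [hg]
  exact form_conj g.2 _ _

theorem hasDerivAt_act (g : Biq) {γ : ℝ → Ambient} {X : Ambient} {t : ℝ}
    (h : HasDerivAt γ X t) : HasDerivAt (fun s => act g (γ s)) (act g X) t := by
  have k {f : ℝ → Biq} {A : Biq} (hf : HasDerivAt f A t) :
      HasDerivAt (fun s => g * f s * gᴴ) (g * A * gᴴ) t := by
    let : NormedRing Biq := Matrix.linftyOpNormedRing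
    let : NormedAlgebra ℝ Biq := Matrix.linftyOpNormedAlgebra
    exact (hf.const_mul g).mul_const _
  rw [hasDerivAt_ambient_iff] at h ⊢
  exact ⟨⟨k h.1.1, k h.1.2⟩, k h.2.1, k h.2.2⟩

theorem IsRelEq.conj {m₁ m₂ : ℝ} {V : ℝ → ℝ} (hV : DifferentiableOn ℝ V (Set.Ioi 1))
    {γ : ℝ → Ambient} (h : IsRelEq m₁ m₂ V γ) (g : SL2C) :
    IsRelEq m₁ m₂ V fun t => act (g : Biq) (γ t) := by
  refine ⟨(isSolution_iff hV).2 fun t => ?_, fun t => ?_⟩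
  · obtain ⟨h1, h2⟩ := (isSolution_iff hV).1 h.1 t
    refine ⟨act_mem_phaseSpace g.2 h1, ?_⟩
    rw [hamField_act _ _ _ g.2]
    exact hasDerivAt_act _ h2
  · obtain ⟨k, hk⟩ := h.2 t
    refine ⟨g * k * g⁻¹, ?_⟩
    simp only [hk, act_act, Matrix.SpecialLinearGroup.coe_mul]
    rw [Matrix.mul_assoc, coe_inv_mul_coe, Matrix.mul_one]

theorem GeneratedBy.conj {ξ : Biq} {γ : ℝ → Ambient} (h : GeneratedBy ξ γ) (g : SL2C) :
    GeneratedBy ((g : Biq) * ξ * ((g⁻¹ : SL2C) : Biq)) fun t => act (g : Biq) (γ t) := by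
  intro t
  have hinv : ((g⁻¹ : SL2C) : Biq) = (g : Biq)⁻¹ :=
    (Matrix.inv_eq_right_inv (coe_mul_coe_inv g)).symm
  have hu : IsUnit (g : Biq) := (Matrix.isUnit_iff_isUnit_det _).2 (by simp)
  have e : NormedSpace.exp (t • ((g : Biq) * ξ * ((g⁻¹ : SL2C) : Biq))) =
      (g : Biq) * NormedSpace.exp (t • ξ) * ((g⁻¹ : SL2C) : Biq) := by
    rw [hinv, ← Matrix.exp_conj _ _ hu, Matrix.mul_smul, Matrix.smul_mul]
  simp only [h t, act_act, e]
  rw [Matrix.mul_assoc _ _ (g : Biq), coe_inv_mul_coe, Matrix.mul_one]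

/-! ### The equations for a generated motion -/

/-- Substituting the momenta leaves a second-order equation for each body. The radial coefficient
`c` is left unspecified because `momentum_eq` recovers it. -/
theorem accel_of_infAct_eq {m₁ m₂ : ℝ} (hm₁ : m₁ ≠ 0) (hm₂ : m₂ ≠ 0) {V : ℝ → ℝ} {ξ : Biq}
    {x : Ambient} (h : infAct ξ x = hamField m₁ m₂ V x) :
    (x.1.2 = -m₁ • infConj ξ x.1.1 ∧ x.2.2 = -m₂ • infConj ξ x.2.1) ∧
    (∃ c : ℝ, m₁ • infConj ξ (infConj ξ x.1.1) =
      deriv V (form x.1.1 x.2.1) • x.2.1 + c • x.1.1) ∧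
    ∃ c : ℝ, m₂ • infConj ξ (infConj ξ x.2.1) =
      deriv V (form x.1.1 x.2.1) • x.1.1 + c • x.2.1 := by
  simp only [infAct, hamField, Prod.mk.injEq] at h
  obtain ⟨⟨h1, h2⟩, h3, h4⟩ := h
  have e1 : x.1.2 = -m₁ • infConj ξ x.1.1 := by
    rw [h1, smul_smul, neg_mul_neg, mul_one_div_cancel hm₁, one_smul]
  have e2 : x.2.2 = -m₂ • infConj ξ x.2.1 := by
    rw [h3, smul_smul, neg_mul_neg, mul_one_div_cancel hm₂, one_smul]
  rw [e1, infConj_real_smul, ← e1] at h2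
  rw [e2, infConj_real_smul, ← e2] at h4
  have k {m a f : ℝ} {u q q' : Biq} (h : -m • u = a • q - f • q') : m • u = f • q' + -a • q := by
    rw [← neg_neg (m • u), ← neg_smul, h]
    module
  exact ⟨⟨e1, e2⟩, ⟨_, k h2⟩, _, k h4⟩

/-- Pairing the second-order equation with the unit vector `q`, and using invariance of the form,
forces `c` to be the coefficient in `hamField`. -/
theorem momentum_eq {m f : ℝ} {ξ q q' : Biq} (hξ : ξ.trace = 0) (hq : form q q = 1)
    {c : ℝ} (h : m • infConj ξ (infConj ξ q) = f • q' + c • q) :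
    infConj ξ (-m • infConj ξ q) =
      (form (-m • infConj ξ q) (-m • infConj ξ q) / m + f * form q q') • q - f • q' := by
  have h1 := form_infConj hξ q (infConj ξ q)
  have h2 : m * form q (infConj ξ (infConj ξ q)) = f * form q q' + c := by
    rw [← form_smul_right, h, form_add_right, form_smul_right, form_smul_right, hq, mul_one]
  have h3 : form (-m • infConj ξ q) (-m • infConj ξ q) / m + f * form q q' = -c := by
    rw [form_smul_left, form_smul_right]
    field_simp
    linear_combination m * h1 - h2
  rw [h3, infConj_real_smul, neg_smul, h, neg_smul]
  abel

/-! ### The generators `S_η` -/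

theorem genS_eq (η : ℂ) : genS η = !![η, 0; 0, -η] := by
  have h : Complex.I * η * Complex.I = -η := by
    rw [mul_right_comm, Complex.I_mul_I, neg_one_mul]
  ext i j
  fin_cases i <;> fin_cases j <;> simp [genS, unitI, h]

theorem trace_genS (η : ℂ) : (genS η).trace = 0 := by
  simp [genS_eq, Matrix.trace_fin_two]

theorem genS_ne_zero {η : ℂ} (hη : η ≠ 0) : genS η ≠ 0 := fun h => hη <| by
  simpa [genS_eq] using congrFun (congrFun h 0) 0

theorem genS_mul_self (η : ℂ) : genS η * genS η = (η ^ 2) • (1 : Biq) := by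
  ext i j
  fin_cases i <;> fin_cases j <;> simp [genS_eq, Matrix.mul_apply, sq]

/-- `S_η` is annihilated by `X² - η²`, which is separable for `η ≠ 0`. -/
theorem isSemisimple_genS {η : ℂ} (hη : η ≠ 0) :
    Module.End.IsSemisimple (Matrix.toLin' (genS η)) := by
  refine Module.End.isSemisimple_of_squarefree_aeval_eq_zero
    (p := Polynomial.X ^ 2 - Polynomial.C (η ^ 2)) ?_ ?_
  · exact (Polynomial.separable_X_pow_sub_C (n := 2) (η ^ 2) (by norm_num)
      (pow_ne_zero 2 hη)).squarefree
  · rw [map_sub, map_pow, Polynomial.aeval_X, Polynomial.aeval_C, sq, Module.End.mul_eq_comp,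
      ← Matrix.toLin'_mul, genS_mul_self, map_smul, Matrix.toLin'_one, sub_eq_zero]
    rfl

theorem det_exp_genS (η : ℂ) (t : ℝ) : (NormedSpace.exp (t • genS η)).det = 1 := by
  have h : t • genS η = Matrix.diagonal ![t * η, -(t * η)] := by
    ext i j
    fin_cases i <;> fin_cases j <;> simp [genS_eq]
  rw [h, Matrix.exp_diagonal, Matrix.det_diagonal, Fin.prod_univ_two]
  simp [Pi.coe_exp, ← Complex.exp_eq_exp_ℂ, ← Complex.exp_add]

theorem infConj_genS_apply (η : ℂ) (A : Biq) :
    infConj (genS η) A 0 0 = 2 * η.re * A 0 0 ∧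
    infConj (genS η) A 0 1 = 2 * (η.im * Complex.I) * A 0 1 ∧
    infConj (genS η) A 1 0 = -(2 * (η.im * Complex.I) * A 1 0) ∧
    infConj (genS η) A 1 1 = -(2 * η.re * A 1 1) := by
  have h1 : (2 * η.re : ℂ) = η + star η := by
    apply Complex.ext <;> simp [two_mul]
  have h2 : (2 * (η.im * Complex.I) : ℂ) = η - star η := by
    apply Complex.ext <;> simp [two_mul]
  rw [h1, h2]
  refine ⟨?_, ?_, ?_, ?_⟩ <;>
    simp only [infConj, genS_eq, Matrix.add_apply, Matrix.mul_apply, Fin.sum_univ_two,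
      Matrix.conjTranspose_apply] <;> simp <;> ring

/-- `Re η` acts as a boost on the diagonal and `Im η` as a rotation on the off-diagonal entries. The
two real eigenvalues of the square differ by `4|η|²`. -/
theorem infConj_infConj_genS_apply (η : ℂ) (A : Biq) :
    infConj (genS η) (infConj (genS η) A) 0 0 = (4 * η.re ^ 2 : ℝ) * A 0 0 ∧
    infConj (genS η) (infConj (genS η) A) 0 1 = (-(4 * η.im ^ 2) : ℝ) * A 0 1 ∧
    infConj (genS η) (infConj (genS η) A) 1 0 = (-(4 * η.im ^ 2) : ℝ) * A 1 0 ∧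
    infConj (genS η) (infConj (genS η) A) 1 1 = (4 * η.re ^ 2 : ℝ) * A 1 1 := by
  obtain ⟨h1, h2, h3, h4⟩ := infConj_genS_apply η A
  obtain ⟨k1, k2, k3, k4⟩ := infConj_genS_apply η (infConj (genS η) A)
  have hI : Complex.I ^ 2 = -1 := Complex.I_sq
  rw [k1, k2, k3, k4, h1, h2, h3, h4]
  push_cast
  refine ⟨by ring, ?_, ?_, by ring⟩
  · linear_combination 4 * (η.im : ℂ) ^ 2 * A 0 1 * hI
  · linear_combination 4 * (η.im : ℂ) ^ 2 * A 1 0 * hI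

/-- A non-zero semisimple element of `sl₂(ℂ)` is conjugate to some `S_η`. -/
theorem exists_conj_eq_genS {ξ : Biq} (h0 : ξ ≠ 0) (htr : ξ.trace = 0)
    (hs : Module.End.IsSemisimple (Matrix.toLin' ξ)) :
    ∃ (g : SL2C) (η : ℂ), η ≠ 0 ∧ (g : Biq) * ξ * ((g⁻¹ : SL2C) : Biq) = genS η := by
  -- An invertible matrix of eigenvectors is enough: rescaling its first column makes the
  -- determinant 1, and the diagonal rescaling commutes with `S_η`.
  suffices H : ∃ (P : Biq) (η : ℂ), η ≠ 0 ∧ P.det ≠ 0 ∧ ξ * P = P * genS η by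
    obtain ⟨P, η, hη, hP, hPξ⟩ := H
    let D : Biq := !![(P.det)⁻¹, 0; 0, 1]
    have hD : (P * D).det = 1 := by
      rw [Matrix.det_mul]
      rw [show D.det = (P.det)⁻¹ by simp [D, Matrix.det_fin_two_of], mul_inv_cancel₀ hP]
    let p : SL2C := ⟨P * D, hD⟩
    refine ⟨p⁻¹, η, hη, ?_⟩
    have hcomm : genS η * D = D * genS η := by
      ext i j
      fin_cases i <;> fin_cases j <;> simp [D, genS_eq, Matrix.mul_apply, mul_comm]
    have e : ξ * (p : Biq) = (p : Biq) * genS η := by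
      change ξ * (P * D) = P * D * genS η
      rw [← Matrix.mul_assoc, hPξ, Matrix.mul_assoc, hcomm, Matrix.mul_assoc]
    rw [inv_inv, Matrix.mul_assoc, e, ← Matrix.mul_assoc, coe_inv_mul_coe, Matrix.one_mul]
  have hd : ξ 1 1 = -ξ 0 0 := by
    rw [Matrix.trace_fin_two] at htr
    linear_combination htr
  -- The eigenvalues of a traceless matrix are the square roots of `-det ξ`. If they vanished, `ξ`
  -- would be nilpotent as well as semisimple, hence zero.
  obtain ⟨η, hη⟩ := IsAlgClosed.exists_pow_nat_eq (ξ 0 0 ^ 2 + ξ 0 1 * ξ 1 0) (n := 2) (by norm_num)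
  have hη0 : η ≠ 0 := by
    rintro rfl
    have hsq : ξ * ξ = 0 := by
      ext i j
      fin_cases i <;> fin_cases j <;> simp [Matrix.mul_apply, hd] <;>
        first | ring1 | linear_combination -hη
    have hnil : IsNilpotent (Matrix.toLin' ξ) :=
      ⟨2, by rw [sq, Module.End.mul_eq_comp, ← Matrix.toLin'_mul, hsq, map_zero]⟩
    exact h0 ((Matrix.toLin').map_eq_zero_iff.1
      (Module.End.eq_zero_of_isNilpotent_isSemisimple hnil hs))
  by_cases hb : ξ 0 1 = 0
  · by_cases hc : ξ 1 0 = 0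
    · have ha : ξ 0 0 ≠ 0 := fun ha => hη0 <| by simpa [ha, hb] using hη
      refine ⟨1, ξ 0 0, ha, by simp, ?_⟩
      ext i j
      fin_cases i <;> fin_cases j <;> simp [genS_eq, hb, hc, hd]
    -- The columns, here and in the last case, are eigenvectors for `η` and `-η`.
    · refine ⟨!![η + ξ 0 0, -η + ξ 0 0; ξ 1 0, ξ 1 0], η, hη0, ?_, ?_⟩
      · rw [Matrix.det_fin_two_of, show (η + ξ 0 0) * ξ 1 0 - (-η + ξ 0 0) * ξ 1 0 =
          2 * (η * ξ 1 0) by ring]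
        exact mul_ne_zero two_ne_zero (mul_ne_zero hη0 hc)
      · ext i j
        fin_cases i <;> fin_cases j <;> simp [genS_eq, Matrix.mul_apply, hd] <;>
          first | ring1 | linear_combination -hη
  · refine ⟨!![ξ 0 1, ξ 0 1; η - ξ 0 0, -η - ξ 0 0], η, hη0, ?_, ?_⟩
    · rw [Matrix.det_fin_two_of, show ξ 0 1 * (-η - ξ 0 0) - ξ 0 1 * (η - ξ 0 0) =
          -2 * (η * ξ 0 1) by ring]
      exact mul_ne_zero (by norm_num) (mul_ne_zero hη0 hb)
    · ext i j
      fin_cases i <;> fin_cases j <;> simp [genS_eq, Matrix.mul_apply, hd] <;>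
        first | ring1 | linear_combination -hη

theorem exists_conjugate_generatedBy_genS {m₁ m₂ : ℝ} {V : ℝ → ℝ}
    (hV : DifferentiableOn ℝ V (Set.Ioi 1)) {γ : ℝ → Ambient}
    (hγ : IsSemisimpleRelEq m₁ m₂ V γ) :
    ∃ (η : ℂ) (γ' : ℝ → Ambient), η ≠ 0 ∧ Conjugate γ γ' ∧ IsRelEq m₁ m₂ V γ' ∧
      GeneratedBy (genS η) γ' := by
  obtain ⟨h, ξ, h0, htr, hs, hgen⟩ := hγ
  obtain ⟨g, η, hη, he⟩ := exists_conj_eq_genS h0 htr hs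
  exact ⟨η, _, hη, ⟨g, fun t => rfl⟩, h.conj hV g, he ▸ hgen.conj g⟩

/-! ### Parabolic relative equilibria -/

theorem not_isParabolicRelEq {m₁ m₂ : ℝ} (hm₁ : 0 < m₁) (hm₂ : 0 < m₂) {V : ℝ → ℝ}
    (hV : DifferentiableOn ℝ V (Set.Ioi 1)) (hatt : StrictlyAttractive V) (γ : ℝ → Ambient) :
    ¬ IsParabolicRelEq m₁ m₂ V γ := by
  rintro ⟨hγ, g, hg⟩
  have hg' := hg.conj g⁻¹
  rw [inv_inv, ← Matrix.mul_assoc, ← Matrix.mul_assoc, coe_inv_mul_coe, Matrix.one_mul,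
    Matrix.mul_assoc, coe_inv_mul_coe, Matrix.mul_one] at hg'
  have hrel := hγ.conj hV g⁻¹
  have hph := (hrel.1 0).1
  have heq := hrel.1.infAct_eq hV hg'
  set x := act ((g⁻¹ : SL2C) : Biq) (γ 0)
  have hf := hatt _ (one_lt_form hph.1.1 hph.2.1.1 hph.2.2)
  obtain ⟨-, ⟨c, hc⟩, ⟨c', hc'⟩⟩ := accel_of_infAct_eq hm₁.ne' hm₂.ne' heq
  obtain ⟨-, a1, a2, -⟩ := mem_H3_iff.1 hph.1.1
  obtain ⟨-, b1, b2, -⟩ := mem_H3_iff.1 hph.2.1.1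
  generalize deriv V (form x.1.1 x.2.1) = f at *
  generalize x.1.1 = q at *
  generalize x.2.1 = q' at *
  have k (A : Biq) : infConj genN (infConj genN A) 0 0 = 2 * A 1 1 ∧
      infConj genN (infConj genN A) 1 1 = 0 := by
    simp only [infConj, genN, Matrix.add_apply, Matrix.mul_apply, Fin.sum_univ_two,
      Matrix.conjTranspose_apply]
    simp [two_mul]
  have e1 := congrArg Complex.re (congrFun (congrFun hc 0) 0)
  have e2 := congrArg Complex.re (congrFun (congrFun hc 1) 1)
  have e3 := congrArg Complex.re (congrFun (congrFun hc' 0) 0)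
  have e4 := congrArg Complex.re (congrFun (congrFun hc' 1) 1)
  simp only [Matrix.smul_apply, Matrix.add_apply, (k q).1, (k q).2, (k q').1, (k q').2] at e1 e2 e3 e4
  simp at e1 e2 e3 e4
  generalize (q 0 0).re = a at *
  generalize (q 1 1).re = d at *
  generalize (q' 0 0).re = a' at *
  generalize (q' 1 1).re = d' at *
  -- Eliminating the multipliers leaves right-hand sides that are opposite for the two bodies, while
  -- both left-hand sides are positive.
  have h1 : 2 * m₁ * d ^ 2 = f * (a' * d - a * d') := by linear_combination d * e1 - a * e2
  have h2 : 2 * m₂ * d' ^ 2 = f * (a * d' - a' * d) := by linear_combination d' * e3 - a' * e4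
  have : 0 < 2 * m₁ * d ^ 2 + 2 * m₂ * d' ^ 2 := by positivity
  linarith

/-! ### Points of the geodesic `χ ↦ e^{χj}` -/

theorem splitExp_eq (χ : ℝ) :
    splitExp χ = !![(Real.cosh χ : ℂ), (Real.sinh χ : ℂ); (Real.sinh χ : ℂ), (Real.cosh χ : ℂ)] := by
  ext i j
  fin_cases i <;> fin_cases j <;> simp [splitExp, unitj, unitK]

theorem splitExp_mem_H3 (χ : ℝ) : splitExp χ ∈ H3 := by
  rw [mem_H3_iff, isHermitian_two_iff, splitExp_eq]
  have := Real.cosh_sq χ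
  simp [-Complex.ofReal_cosh, -Complex.ofReal_sinh, Real.cosh_pos]
  linarith

theorem form_splitExp (χ₁ χ₂ : ℝ) :
    form (splitExp χ₁) (splitExp (-χ₂)) = Real.cosh (χ₁ + χ₂) := by
  rw [form_eq_of_isHermitian (splitExp_mem_H3 _).1 (splitExp_mem_H3 _).1, Real.cosh_add]
  simp [-Complex.ofReal_cosh, -Complex.ofReal_sinh, splitExp_eq]

theorem eq_splitExp {q : Biq} (hq : q ∈ H3) (h : (q 0 0).re = (q 1 1).re)
    (h' : (q 0 1).im = 0) : q = splitExp (Real.arsinh (q 0 1).re) := by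
  obtain ⟨h1, h2, h3, h4⟩ := mem_H3_iff.1 hq
  have hc : (q 0 0).re = Real.cosh (Real.arsinh (q 0 1).re) := by
    rw [Real.cosh_arsinh, eq_comm, Real.sqrt_eq_iff_mul_self_eq (by positivity) h2.le]
    rw [h', ← h] at h4
    linarith
  refine eq_of_isHermitian h1 (splitExp_mem_H3 _).1 ?_ ?_ ?_ ?_ <;>
    simp only [splitExp_eq, Matrix.of_apply, Matrix.cons_val', Matrix.cons_val_zero,
      Matrix.cons_val_one, Matrix.cons_val_fin_one, Complex.ofReal_re, Complex.ofReal_im, ← hc,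
      Real.sinh_arsinh, h, h']

/-- A diagonal element of `SL₂(ℂ)` commutes with `S_η` and moves the bodies to the geodesic
`χ ↦ e^{χj}`. -/
theorem exists_conj_eq_splitExp {m f c : ℝ} {η : ℂ} {q q' : Biq} (hq : q ∈ H3) (hq' : q' ∈ H3)
    (hne : q ≠ q') (hf : f ≠ 0)
    (h : m • infConj (genS η) (infConj (genS η) q) = f • q' + c • q) :
    ∃ (g : SL2C) (χ₁ χ₂ : ℝ), 0 < χ₁ ∧ (g : Biq) * genS η * ((g⁻¹ : SL2C) : Biq) = genS η ∧
      (g : Biq) * q * (g : Biq)ᴴ = splitExp χ₁ ∧ (g : Biq) * q' * (g : Biq)ᴴ = splitExp (-χ₂) := by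
  obtain ⟨a1, a2, a3, a4⟩ := mem_H3_iff.1 hq
  obtain ⟨b1, b2, b3, b4⟩ := mem_H3_iff.1 hq'
  obtain ⟨k1, k2, -, k4⟩ := infConj_infConj_genS_apply η q
  have e1 := congrArg Complex.re (congrFun (congrFun h 0) 0)
  have e2 := congrFun (congrFun h 0) 1
  have e4 := congrArg Complex.re (congrFun (congrFun h 1) 1)
  simp only [Matrix.smul_apply, Matrix.add_apply, k1, k2, k4, Complex.real_smul, Complex.add_re,
    Complex.re_ofReal_mul] at e1 e2 e4
  have e2r := congrArg Complex.re e2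
  have e2i := congrArg Complex.im e2
  simp only [Complex.add_re, Complex.re_ofReal_mul, Complex.add_im, Complex.im_ofReal_mul]
    at e2r e2i
  -- Both diagonal entries carry the same eigenvalue, so eliminating `c` makes the diagonals of `q`
  -- and `q'` proportional. The off-diagonal entries become parallel over `ℝ` in the same way.
  have had : (q' 0 0).re * (q 1 1).re = (q 0 0).re * (q' 1 1).re := by
    apply mul_left_cancel₀ hf
    linear_combination (q 0 0).re * e4 - (q 1 1).re * e1
  have hbb : (q' 0 1).re * (q 0 1).im = (q 0 1).re * (q' 0 1).im := by
    apply mul_left_cancel₀ hf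
    linear_combination (q 0 1).re * e2i - (q 0 1).im * e2r
  -- Otherwise `q'` is diagonal too, and two diagonal points of `H³` with proportional diagonals
  -- coincide, which would be a collision.
  have hb : q 0 1 ≠ 0 := by
    intro hb
    rw [hb] at e2r e2i a4
    simp only [Complex.zero_re, Complex.zero_im, mul_zero, add_zero, zero_eq_mul, hf,
      false_or] at e2r e2i
    rw [e2r, e2i] at b4
    simp only [Complex.zero_re, Complex.zero_im] at a4
    have haa : (q 0 0).re ^ 2 = (q' 0 0).re ^ 2 := by
      linear_combination (q' 0 0).re ^ 2 * a4 - (q 0 0).re * (q' 0 0).re * had -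
        (q 0 0).re ^ 2 * b4
    have haa' : (q 0 0).re = (q' 0 0).re := (sq_eq_sq₀ a2.le b2.le).1 haa
    rw [haa'] at had
    exact hne (eq_of_isHermitian a1 b1 haa' (mul_left_cancel₀ b2.ne' had)
      (by simp [hb, e2r]) (by simp [hb, e2i]))
  set b := q 0 1 with hbdef
  set ρ := Real.sqrt ((q 1 1).re / (q 0 0).re) with hρdef
  have hρ : 0 < ρ := Real.sqrt_pos.2 (div_pos a3 a2)
  have hρ2 : ρ ^ 2 * (q 0 0).re = (q 1 1).re := by
    rw [Real.sq_sqrt (div_pos a3 a2).le, div_mul_cancel₀ _ a2.ne']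
  have hρ2' : ρ ^ 2 * (q' 0 0).re = (q' 1 1).re := by
    apply mul_left_cancel₀ a2.ne'
    linear_combination (q' 0 0).re * hρ2 + had
  have hnb : 0 < ‖b‖ := norm_pos_iff.2 hb
  -- For `g = diag(s, s⁻¹)`, the modulus `|s|² = ρ` equalises the diagonal entries of both bodies,
  -- and the argument of `s` rotates `b` to the positive real axis.
  obtain ⟨s, hs⟩ := IsAlgClosed.exists_pow_nat_eq ((ρ / ‖b‖ : ℝ) * star b) (n := 2) (by norm_num)
  have hns : ‖s‖ ^ 2 = ρ := by
    rw [← norm_pow, hs, norm_mul, norm_star, Complex.norm_real, Real.norm_of_nonneg (by positivity),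
      div_mul_cancel₀ _ hnb.ne']
  have hs0 : s ≠ 0 := by
    rintro rfl
    simp at hns
    exact hρ.ne hns
  have hss : s * star s = ρ := by
    rw [← hns, Complex.star_def, Complex.mul_conj, Complex.normSq_eq_norm_sq]
  have hsi : s⁻¹ * star s⁻¹ = (ρ⁻¹ : ℝ) := by
    rw [star_inv₀, ← mul_inv, hss, Complex.ofReal_inv]
  have hsb : s * star s⁻¹ = (‖b‖⁻¹ : ℝ) * star b := by
    have hs1 : star s ≠ 0 := star_ne_zero.2 hs0
    have : s * star s⁻¹ = s ^ 2 * (s * star s)⁻¹ := by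
      rw [star_inv₀]
      field_simp
    rw [this, hs, hss]
    have : (ρ : ℂ) ≠ 0 := Complex.ofReal_ne_zero.2 hρ.ne'
    push_cast
    field_simp
  let g : SL2C := ⟨!![s, 0; 0, s⁻¹], by simp [Matrix.det_fin_two_of, hs0]⟩
  have hg (A : Biq) : ((g : Biq) * A * (g : Biq)ᴴ) 0 0 = ρ * A 0 0 ∧
      ((g : Biq) * A * (g : Biq)ᴴ) 1 1 = (ρ⁻¹ : ℝ) * A 1 1 ∧
      ((g : Biq) * A * (g : Biq)ᴴ) 0 1 = (‖b‖⁻¹ : ℝ) * (star b * A 0 1) := by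
    rw [← mul_assoc, ← hsb, ← hsi, ← hss]
    simp only [g, Matrix.mul_apply, Fin.sum_univ_two, Matrix.conjTranspose_apply]
    refine ⟨?_, ?_, ?_⟩ <;> simp <;> ring
  have hdiag {A : Biq} (hA : ρ ^ 2 * (A 0 0).re = (A 1 1).re) :
      (((g : Biq) * A * (g : Biq)ᴴ) 0 0).re = (((g : Biq) * A * (g : Biq)ᴴ) 1 1).re := by
    rw [(hg A).1, (hg A).2.1, Complex.re_ofReal_mul, Complex.re_ofReal_mul, ← hA]
    field_simp
  refine ⟨g, Real.arsinh (((g : Biq) * q * (g : Biq)ᴴ) 0 1).re,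
    -Real.arsinh (((g : Biq) * q' * (g : Biq)ᴴ) 0 1).re, ?_, ?_,
    eq_splitExp (conj_mem_H3 g.2 hq) (hdiag hρ2) ?_, ?_⟩
  · rw [Real.arsinh_pos_iff, (hg q).2.2, Complex.re_ofReal_mul, Complex.star_def,
      Complex.normSq_eq_conj_mul_self.symm, Complex.ofReal_re]
    exact mul_pos (inv_pos.2 hnb) (Complex.normSq_pos.2 hb)
  · have : (g : Biq) * genS η = genS η * (g : Biq) := by
      ext i j
      fin_cases i <;> fin_cases j <;> simp [g, genS_eq, Matrix.mul_apply, mul_comm]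
    rw [this, Matrix.mul_assoc, coe_mul_coe_inv, Matrix.mul_one]
  · rw [(hg q).2.2, Complex.im_ofReal_mul, Complex.star_def,
      Complex.normSq_eq_conj_mul_self.symm, Complex.ofReal_im, mul_zero]
  · rw [neg_neg]
    refine eq_splitExp (conj_mem_H3 g.2 hq') (hdiag hρ2') ?_
    rw [(hg q').2.2, Complex.im_ofReal_mul, Complex.star_def, Complex.mul_im, Complex.conj_re,
      Complex.conj_im]
    linear_combination (-‖b‖⁻¹) * hbb

/-! ### Relative equilibria in standard position -/

/-- Eliminating `c` between the diagonal and off-diagonal equations combines `4(Re η)²` and `4(Im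
η)²` into `4|η|²`; the argument of `η` disappears, which is why the phase is free. -/
theorem accel_splitExp_iff {m f : ℝ} {η : ℂ} {χ χ' : ℝ} :
    (∃ c : ℝ, m • infConj (genS η) (infConj (genS η) (splitExp χ)) =
      f • splitExp (-χ') + c • splitExp χ) ↔
    2 * m * ‖η‖ ^ 2 * Real.sinh (2 * χ) = f * Real.sinh (χ + χ') := by
  have hn : ‖η‖ ^ 2 = η.re ^ 2 + η.im ^ 2 := by
    rw [← Complex.normSq_eq_norm_sq, Complex.normSq_apply]; ring
  obtain ⟨k1, k2, k3, k4⟩ := infConj_infConj_genS_apply η (splitExp χ)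
  rw [hn, Real.sinh_two_mul, Real.sinh_add]
  have hc := Real.cosh_pos χ
  have key (c : ℝ) : m • infConj (genS η) (infConj (genS η) (splitExp χ)) =
      f • splitExp (-χ') + c • splitExp χ ↔
      m * (4 * η.re ^ 2 * Real.cosh χ) = f * Real.cosh χ' + c * Real.cosh χ ∧
      m * (-(4 * η.im ^ 2) * Real.sinh χ) = f * -Real.sinh χ' + c * Real.sinh χ := by
    rw [← Matrix.ext_iff]
    simp only [Fin.forall_fin_two, Matrix.smul_apply, Matrix.add_apply, k1, k2, k3, k4]
    simp only [splitExp_eq, Real.cosh_neg, Real.sinh_neg, Matrix.of_apply, Matrix.cons_val',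
      Matrix.cons_val_zero, Matrix.cons_val_one, Matrix.cons_val_fin_one, Complex.real_smul]
    norm_cast
    tauto
  simp only [key]
  constructor
  · rintro ⟨c, h1, h2⟩
    linear_combination Real.sinh χ * h1 - Real.cosh χ * h2
  · intro h
    refine ⟨(m * (4 * η.re ^ 2 * Real.cosh χ) - f * Real.cosh χ') / Real.cosh χ, ?_, ?_⟩
    · rw [div_mul_cancel₀ _ hc.ne']; ring
    · field_simp
      linear_combination -h

/-! ### Phase and separation -/

theorem exists_conjugate_arg_mem {m₁ m₂ : ℝ} {V : ℝ → ℝ}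
    (hV : DifferentiableOn ℝ V (Set.Ioi 1)) {γ : ℝ → Ambient} (hγ : IsRelEq m₁ m₂ V γ) {η : ℂ}
    (hη : η ≠ 0) (hgen : GeneratedBy (genS η) γ) :
    ∃ (η' : ℂ) (γ' : ℝ → Ambient), η' ≠ 0 ∧ η'.arg ∈ Ico 0 Real.pi ∧ Conjugate γ γ' ∧
      IsRelEq m₁ m₂ V γ' ∧ GeneratedBy (genS η') γ' := by
  by_cases h : η.arg ∈ Ico 0 Real.pi
  · exact ⟨η, γ, hη, h, ⟨1, fun t => by rw [Matrix.SpecialLinearGroup.coe_one, act_one]⟩, hγ, hgen⟩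
  -- Conjugation by `K` swaps the two eigenlines of `S_η`, replacing `η` by `-η`.
  · let g : SL2C := ⟨unitK, by simp [unitK, Matrix.det_fin_two_of]⟩
    refine ⟨-η, _, neg_ne_zero.2 hη, ?_, ⟨g, fun t => rfl⟩, hγ.conj hV g, ?_⟩
    · have hpi := Real.pi_pos
      rcases lt_or_ge η.im 0 with him | him
      · rw [Complex.arg_neg_eq_arg_add_pi_of_im_neg him]
        have := Complex.neg_pi_lt_arg η
        have := Complex.arg_neg_iff.2 him
        exact ⟨by linarith, by linarith⟩
      · have h1 : η.arg = Real.pi := by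
          by_contra hne
          exact h ⟨Complex.arg_nonneg_iff.2 him, lt_of_le_of_ne (Complex.arg_le_pi η) hne⟩
        obtain ⟨h2, h3⟩ := Complex.arg_eq_pi_iff.1 h1
        have : (-η).arg = 0 := Complex.arg_eq_zero_iff.2 ⟨by simp [h2.le], by simp [h3]⟩
        rw [this]
        exact ⟨le_rfl, hpi⟩
    · have h1 : (g : Biq) * genS η = genS (-η) * (g : Biq) := by
        ext i j
        fin_cases i <;> fin_cases j <;> simp [g, unitK, genS_eq, Matrix.mul_apply, mul_comm]
      have h2 := hgen.conj g
      rwa [h1, Matrix.mul_assoc, coe_mul_coe_inv, Matrix.mul_one] at h2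

theorem exists_isStandardRelEq {m₁ m₂ : ℝ} (hm₁ : 0 < m₁) (hm₂ : 0 < m₂) {V : ℝ → ℝ}
    (hV : DifferentiableOn ℝ V (Set.Ioi 1)) {γ : ℝ → Ambient} (hγ : IsSemisimpleRelEq m₁ m₂ V γ)
    (hf : deriv V (form (γ 0).1.1 (γ 0).2.1) ≠ 0) :
    0 < deriv V (form (γ 0).1.1 (γ 0).2.1) ∧
      ∃ (θ ψ : ℝ) (γ' : ℝ → Ambient), θ ∈ Ico 0 Real.pi ∧ 0 < ψ ∧
        form (γ 0).1.1 (γ 0).2.1 = Real.cosh ψ ∧ Conjugate γ γ' ∧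
        IsStandardRelEq m₁ m₂ V θ ψ γ' := by
  obtain ⟨η₀, γ₀, hη₀, hc₀, hr₀, hg₀⟩ := exists_conjugate_generatedBy_genS hV hγ
  obtain ⟨η, γ₁, hη, hθ, hc₁, hr₁, hg₁⟩ := exists_conjugate_arg_mem hV hr₀ hη₀ hg₀
  have hc₂ := hc₀.trans hc₁
  have hph₁ := (hr₁.1 0).1
  obtain ⟨-, ⟨c, hc⟩, -⟩ := accel_of_infAct_eq hm₁.ne' hm₂.ne' (hr₁.1.infAct_eq hV hg₁)
  rw [hc₂.form_eq] at hc
  obtain ⟨g, χ₁, χ₂, hχ₁, hg, hq, hq'⟩ :=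
    exists_conj_eq_splitExp hph₁.1.1 hph₁.2.1.1 hph₁.2.2 hf hc
  have hc₃ : Conjugate γ fun t => act (g : Biq) (γ₁ t) := hc₂.trans ⟨g, fun t => rfl⟩
  have hr := hr₁.conj hV g
  have hgen := hg₁.conj g
  rw [hg] at hgen
  generalize hγ' : (fun t => act (g : Biq) (γ₁ t)) = γ' at *
  have e₁ : (γ' 0).1.1 = splitExp χ₁ := by rw [← hγ']; exact hq
  have e₂ : (γ' 0).2.1 = splitExp (-χ₂) := by rw [← hγ']; exact hq'
  have hform : form (γ 0).1.1 (γ 0).2.1 = Real.cosh (χ₁ + χ₂) := by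
    rw [← hc₃.form_eq, e₁, e₂, form_splitExp]
  obtain ⟨-, hA, hB⟩ := accel_of_infAct_eq hm₁.ne' hm₂.ne' (hr.1.infAct_eq hV hgen)
  rw [hc₃.form_eq, e₁, e₂] at hA hB
  have hA' := accel_splitExp_iff.1 hA
  -- The second body sits at parameter `-χ₂` and sees the first at `χ₁ = -(-χ₁)`.
  have hB' := accel_splitExp_iff (χ := -χ₂) (χ' := -χ₁) |>.1 (by rwa [neg_neg])
  rw [show 2 * -χ₂ = -(2 * χ₂) by ring, show -χ₂ + -χ₁ = -(χ₁ + χ₂) by ring, Real.sinh_neg,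
    Real.sinh_neg, mul_neg, mul_neg, neg_inj] at hB'
  have hk : 0 < ‖η‖ ^ 2 := by positivity
  have hS : m₁ * Real.sinh (2 * χ₁) = m₂ * Real.sinh (2 * χ₂) := by
    apply mul_left_cancel₀ hk.ne'
    linear_combination (hA' - hB') / 2
  have hs₁ : 0 < Real.sinh (2 * χ₁) := Real.sinh_pos_iff.2 (by linarith)
  have hχ₂ : 0 < χ₂ := by
    have : 0 < m₂ * Real.sinh (2 * χ₂) := hS ▸ mul_pos hm₁ hs₁
    have := Real.sinh_pos_iff.1 (pos_of_mul_pos_right this hm₂.le)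
    linarith
  have hψ : 0 < χ₁ + χ₂ := add_pos hχ₁ hχ₂
  have hsψ : 0 < Real.sinh (χ₁ + χ₂) := Real.sinh_pos_iff.2 hψ
  refine ⟨?_, η.arg, χ₁ + χ₂, γ', hθ, hψ, hform, hc₃, hr, η, χ₁, χ₂, hη, rfl, hgen, hχ₁, hχ₂, rfl,
    hS, e₁, e₂, ?_⟩
  -- The sign of the force is that of `2m₁|η|² sinh 2χ₁`, since `sinh ψ > 0`.
  · refine pos_of_mul_pos_left ?_ hsψ.le
    rw [← hA']
    positivity
  · rw [← hform, ← hA']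
    field_simp

theorem exists_hasPhaseSeparation {m₁ m₂ : ℝ} (hm₁ : 0 < m₁) (hm₂ : 0 < m₂) {V : ℝ → ℝ}
    (hV : DifferentiableOn ℝ V (Set.Ioi 1)) {γ : ℝ → Ambient} (hγ : IsSemisimpleRelEq m₁ m₂ V γ)
    (hf : deriv V (form (γ 0).1.1 (γ 0).2.1) ≠ 0) :
    ∃ θ ψ : ℝ, HasPhaseSeparation m₁ m₂ V θ ψ γ := by
  obtain ⟨-, θ, ψ, γ', hθ, hψ, hform, hc, hs⟩ := exists_isStandardRelEq hm₁ hm₂ hV hγ hf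
  refine ⟨θ, ψ, hθ, hψ, fun t => ?_, γ', hc, hs⟩
  rw [hypDist, hγ.1.form_eq, hform, Real.arcosh_cosh hψ.le]

theorem HasPhaseSeparation.of_conjugate {m₁ m₂ : ℝ} {V : ℝ → ℝ} {γ γ' : ℝ → Ambient} {θ ψ : ℝ}
    (h : HasPhaseSeparation m₁ m₂ V θ ψ γ) (hc : Conjugate γ γ') :
    HasPhaseSeparation m₁ m₂ V θ ψ γ' := by
  obtain ⟨h1, h2, h3, γ'', h4, h5⟩ := h
  refine ⟨h1, h2, fun t => ?_, γ'', hc.symm.trans h4, h5⟩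
  rw [hypDist, hc.form_eq]
  exact h3 t

/-- The separation determines the positions on the geodesic `χ ↦ e^{χj}`. -/
theorem existsUnique_split {m₁ m₂ : ℝ} (hm₁ : 0 < m₁) (hm₂ : 0 < m₂) {ψ : ℝ} (hψ : 0 < ψ) :
    ∃! χ : ℝ × ℝ, 0 < χ.1 ∧ 0 < χ.2 ∧ χ.1 + χ.2 = ψ ∧
      m₁ * Real.sinh (2 * χ.1) = m₂ * Real.sinh (2 * χ.2) := by
  -- With `χ₂ = ψ - χ`, the balance condition asks for a zero of a strictly increasing function that
  -- changes sign on `[0, ψ]`.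
  let F : ℝ → ℝ := fun χ => m₁ * Real.sinh (2 * χ) - m₂ * Real.sinh (2 * (ψ - χ))
  have hmono : StrictMono F := by
    intro a b hab
    have h1 : Real.sinh (2 * a) < Real.sinh (2 * b) := Real.sinh_strictMono (by linarith)
    have h2 : Real.sinh (2 * (ψ - b)) < Real.sinh (2 * (ψ - a)) :=
      Real.sinh_strictMono (by linarith)
    have h3 := mul_lt_mul_of_pos_left h1 hm₁
    have h4 := mul_lt_mul_of_pos_left h2 hm₂
    simp only [F]
    linarith
  have hcont : Continuous F := by
    have := Real.continuous_sinh
    fun_prop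
  have hpos : 0 < Real.sinh (2 * ψ) := Real.sinh_pos_iff.2 (by linarith)
  have h0 : F 0 < 0 := by
    simp only [F, mul_zero, Real.sinh_zero, sub_zero]
    nlinarith
  have h1 : 0 < F ψ := by
    simp only [F, sub_self, mul_zero, Real.sinh_zero, sub_zero]
    positivity
  obtain ⟨χ, ⟨hχ0, hχ1⟩, hχ⟩ := intermediate_value_Ioo hψ.le hcont.continuousOn ⟨h0, h1⟩
  refine ⟨(χ, ψ - χ), ⟨hχ0, by simpa using hχ1, by simp, sub_eq_zero.1 hχ⟩, ?_⟩
  rintro ⟨a, b⟩ ⟨-, -, hab, he⟩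
  simp only at hab he
  obtain rfl : b = ψ - a := by linarith
  have : a = χ := hmono.injective ((sub_eq_zero.2 he).trans hχ.symm)
  rw [this]

/-- The initial momenta of a motion generated by `ξ` are determined by its positions. -/
theorem IsRelEq.momenta {m₁ m₂ : ℝ} (hm₁ : 0 < m₁) (hm₂ : 0 < m₂) {V : ℝ → ℝ}
    (hV : DifferentiableOn ℝ V (Set.Ioi 1)) {γ : ℝ → Ambient} (hγ : IsRelEq m₁ m₂ V γ) {ξ : Biq}
    (hgen : GeneratedBy ξ γ) : (γ 0).1.2 = -m₁ • infConj ξ (γ 0).1.1 ∧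
      (γ 0).2.2 = -m₂ • infConj ξ (γ 0).2.1 :=
  (accel_of_infAct_eq hm₁.ne' hm₂.ne' (hγ.1.infAct_eq hV hgen)).1

/-- The separation fixes the positions and `|η|`, the phase fixes `arg η`, and the generator with
the positions fixes the momenta; so the curves are equal, not merely conjugate. -/
theorem IsStandardRelEq.unique {m₁ m₂ : ℝ} (hm₁ : 0 < m₁) (hm₂ : 0 < m₂) {V : ℝ → ℝ}
    (hV : DifferentiableOn ℝ V (Set.Ioi 1)) {θ ψ : ℝ} (hψ : 0 < ψ) {γ γ' : ℝ → Ambient}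
    (h : IsStandardRelEq m₁ m₂ V θ ψ γ) (h' : IsStandardRelEq m₁ m₂ V θ ψ γ') : γ = γ' := by
  obtain ⟨hr, η, χ₁, χ₂, -, harg, hgen, h1, h2, h3, h4, e1, e2, hn⟩ := h
  obtain ⟨hr', η', χ₁', χ₂', -, harg', hgen', h1', h2', h3', h4', e1', e2', hn'⟩ := h'
  have hχ := (existsUnique_split hm₁ hm₂ hψ).unique (y₁ := (χ₁, χ₂)) (y₂ := (χ₁', χ₂'))
    ⟨h1, h2, h3, h4⟩ ⟨h1', h2', h3', h4'⟩
  obtain ⟨rfl, rfl⟩ := Prod.mk.inj hχ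
  have hη : η = η' := by
    refine Complex.ext_norm_arg ?_ (harg.trans harg'.symm)
    exact (sq_eq_sq₀ (norm_nonneg _) (norm_nonneg _)).1 (hn.trans hn'.symm)
  subst hη
  obtain ⟨p1, p2⟩ := hr.momenta hm₁ hm₂ hV hgen
  obtain ⟨p1', p2'⟩ := hr'.momenta hm₁ hm₂ hV hgen'
  have h0 : γ 0 = γ' 0 := by
    refine Prod.ext (Prod.ext (e1.trans e1'.symm) ?_) (Prod.ext (e2.trans e2'.symm) ?_)
    · rw [p1, p1', e1, e1']
    · rw [p2, p2', e2, e2']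
  funext t
  rw [hgen t, hgen' t, h0]

/-- The determinant of the momentum of the `SL₂(ℂ)`-action. -/
def momentDet (x : Ambient) : ℂ :=
  (x.1.2 * x.1.1.adjugate + x.2.2 * x.2.1.adjugate).det

/-- On `H³` the adjugate of `q` is `q⁻¹`, and `p q⁻¹` transforms by `g (p q⁻¹) g⁻¹`. Working with
the adjugate avoids any invertibility assumption on `q`. -/
theorem momentDet_act {g : Biq} (hg : g.det = 1) (x : Ambient) :
    momentDet (act g x) = momentDet x := by
  have k (A B : Biq) : (g * A * gᴴ) * (g * B * gᴴ).adjugate = g * (A * B.adjugate) * g.adjugate := by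
    rw [Matrix.adjugate_mul_distrib, Matrix.adjugate_mul_distrib, ← Matrix.mul_assoc,
      Matrix.mul_assoc (g * A), Matrix.mul_adjugate, Matrix.det_conjTranspose, hg, star_one,
      one_smul, Matrix.mul_one]
    simp only [Matrix.mul_assoc]
  simp only [momentDet, act, k]
  rw [← Matrix.add_mul, ← Matrix.mul_add, Matrix.det_mul, Matrix.det_mul, Matrix.det_adjugate, hg]
  simp

theorem infConj_genS_mul_adjugate (η : ℂ) (χ : ℝ) :
    infConj (genS η) (splitExp χ) * (splitExp χ).adjugate =
      !![2 * (Real.cosh χ ^ 2 * η.re - Real.sinh χ ^ 2 * (η.im * Complex.I)),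
        -(2 * (Real.sinh χ * Real.cosh χ) * (η.re - η.im * Complex.I));
        2 * (Real.sinh χ * Real.cosh χ) * (η.re - η.im * Complex.I),
        -(2 * (Real.cosh χ ^ 2 * η.re - Real.sinh χ ^ 2 * (η.im * Complex.I)))] := by
  obtain ⟨a1, a2, a3, a4⟩ := infConj_genS_apply η (splitExp χ)
  rw [← Matrix.ext_iff]
  simp only [Fin.forall_fin_two, Matrix.mul_apply, Fin.sum_univ_two, a1, a2, a3, a4]
  simp only [Matrix.adjugate_fin_two, splitExp_eq, Matrix.of_apply, Matrix.cons_val', Matrix.cons_val_zero,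
    Matrix.cons_val_one, Matrix.cons_val_fin_one]
  refine ⟨⟨?_, ?_⟩, ?_, ?_⟩ <;> ring

/-- The balance condition cancels the off-diagonal part of the total momentum. What is left is
diagonal and traceless, so its determinant is minus a square. -/
theorem momentDet_eq {m₁ m₂ : ℝ} (hm₁ : 0 < m₁) (hm₂ : 0 < m₂) {V : ℝ → ℝ}
    (hV : DifferentiableOn ℝ V (Set.Ioi 1)) {γ : ℝ → Ambient} (hγ : IsRelEq m₁ m₂ V γ) {η : ℂ}
    {χ₁ χ₂ : ℝ} (hgen : GeneratedBy (genS η) γ)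
    (hS : m₁ * Real.sinh (2 * χ₁) = m₂ * Real.sinh (2 * χ₂))
    (e₁ : (γ 0).1.1 = splitExp χ₁) (e₂ : (γ 0).2.1 = splitExp (-χ₂)) :
    momentDet (γ 0) = -4 * ((m₁ * Real.cosh χ₁ ^ 2 + m₂ * Real.cosh χ₂ ^ 2) * η.re -
      (m₁ * Real.sinh χ₁ ^ 2 + m₂ * Real.sinh χ₂ ^ 2) * (η.im * Complex.I)) ^ 2 := by
  obtain ⟨p1, p2⟩ := hγ.momenta hm₁ hm₂ hV hgen
  have hS' : (m₁ : ℂ) * (Real.sinh χ₁ * Real.cosh χ₁) = m₂ * (Real.sinh χ₂ * Real.cosh χ₂) := by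
    rw [Real.sinh_two_mul, Real.sinh_two_mul] at hS
    exact_mod_cast (by linarith : m₁ * (Real.sinh χ₁ * Real.cosh χ₁) =
      m₂ * (Real.sinh χ₂ * Real.cosh χ₂))
  rw [momentDet, p1, p2, e₁, e₂, Matrix.smul_mul, Matrix.smul_mul, infConj_genS_mul_adjugate,
    infConj_genS_mul_adjugate, Matrix.det_fin_two]
  simp only [Matrix.add_apply, Matrix.smul_apply, Real.cosh_neg, Real.sinh_neg, Matrix.of_apply,
    Matrix.cons_val', Matrix.cons_val_zero, Matrix.cons_val_one, Matrix.cons_val_fin_one,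
    Complex.real_smul, Complex.ofReal_neg]
  generalize (η.im * Complex.I : ℂ) = y
  linear_combination 4 * (η.re - y) ^ 2 * (m₁ * (Real.sinh χ₁ * Real.cosh χ₁) -
    m₂ * (Real.sinh χ₂ * Real.cosh χ₂)) * hS'

theorem IsStandardRelEq.phase_unique {m₁ m₂ : ℝ} (hm₁ : 0 < m₁) (hm₂ : 0 < m₂) {V : ℝ → ℝ}
    (hV : DifferentiableOn ℝ V (Set.Ioi 1)) {θ θ' ψ : ℝ} (hψ : 0 < ψ) (hθ : θ ∈ Ico 0 Real.pi)
    (hθ' : θ' ∈ Ico 0 Real.pi) {γ γ' : ℝ → Ambient}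
    (h : IsStandardRelEq m₁ m₂ V θ ψ γ) (h' : IsStandardRelEq m₁ m₂ V θ' ψ γ')
    (hc : Conjugate γ γ') : θ = θ' := by
  obtain ⟨hr, η, χ₁, χ₂, hη, harg, hgen, h1, h2, h3, h4, e1, e2, -⟩ := h
  obtain ⟨hr', η', χ₁', χ₂', hη', harg', hgen', h1', h2', h3', h4', e1', e2', -⟩ := h'
  have hχ := (existsUnique_split hm₁ hm₂ hψ).unique (y₁ := (χ₁, χ₂)) (y₂ := (χ₁', χ₂'))
    ⟨h1, h2, h3, h4⟩ ⟨h1', h2', h3', h4'⟩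
  obtain ⟨rfl, rfl⟩ := Prod.mk.inj hχ
  have hd : momentDet (γ' 0) = momentDet (γ 0) := by
    obtain ⟨g, hg⟩ := hc
    rw [hg, momentDet_act g.2]
  rw [momentDet_eq hm₁ hm₂ hV hr hgen h4 e1 e2,
    momentDet_eq hm₁ hm₂ hV hr' hgen' h4 e1' e2'] at hd
  have hP : m₁ * Real.cosh χ₁ ^ 2 + m₂ * Real.cosh χ₂ ^ 2 ≠ 0 := by
    have := Real.cosh_pos χ₁
    positivity
  have hQ : m₁ * Real.sinh χ₁ ^ 2 + m₂ * Real.sinh χ₂ ^ 2 ≠ 0 := by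
    have := Real.sinh_pos_iff.2 h1
    positivity
  have hd' := sq_eq_sq_iff_eq_or_eq_neg.1 (mul_left_cancel₀ (by norm_num) hd)
  norm_cast at hd'
  generalize m₁ * Real.cosh χ₁ ^ 2 + m₂ * Real.cosh χ₂ ^ 2 = P at *
  generalize m₁ * Real.sinh χ₁ ^ 2 + m₂ * Real.sinh χ₂ ^ 2 = Q at *
  -- The invariant fixes `P Re η - iQ Im η` up to sign, and the real numbers `P` and `Q` are
  -- non-zero.
  have hη' : η' = η ∨ η' = -η := by
    simp only [Complex.ext_iff, Complex.sub_re, Complex.sub_im, Complex.neg_re, Complex.neg_im,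
      Complex.ofReal_re, Complex.ofReal_im, Complex.mul_re, Complex.mul_im, Complex.I_re,
      Complex.I_im, mul_zero, mul_one, zero_mul, sub_zero, zero_sub, add_zero] at hd' ⊢
    refine hd'.imp (fun h => ⟨mul_left_cancel₀ hP ?_, mul_left_cancel₀ hQ ?_⟩)
      (fun h => ⟨mul_left_cancel₀ hP ?_, mul_left_cancel₀ hQ ?_⟩) <;> linarith [h.1, h.2]
  rcases hη' with rfl | rfl
  · exact harg.symm.trans harg'
  -- Non-zero `η` and `-η` cannot both have argument in `[0, π)`.
  · exfalso
    rw [← harg] at hθ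
    rw [← harg'] at hθ'
    have i1 := Complex.arg_nonneg_iff.1 hθ.1
    have i2 := Complex.arg_nonneg_iff.1 hθ'.1
    rw [Complex.neg_im] at i2
    have i3 : η.im = 0 := by linarith
    have i4 : η.re ≠ 0 := fun h => hη (Complex.ext h i3)
    rcases lt_or_gt_of_ne i4 with h | h
    · exact hθ.2.ne (Complex.arg_eq_pi_iff.2 ⟨h, i3⟩)
    · exact hθ'.2.ne (Complex.arg_eq_pi_iff.2 ⟨by simpa using h, by simp [i3]⟩)

theorem HasPhaseSeparation.unique {m₁ m₂ : ℝ} (hm₁ : 0 < m₁) (hm₂ : 0 < m₂) {V : ℝ → ℝ}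
    (hV : DifferentiableOn ℝ V (Set.Ioi 1)) {θ θ' ψ ψ' : ℝ} {γ : ℝ → Ambient}
    (h : HasPhaseSeparation m₁ m₂ V θ ψ γ) (h' : HasPhaseSeparation m₁ m₂ V θ' ψ' γ) :
    θ = θ' ∧ ψ = ψ' := by
  obtain ⟨hθ, hψ, hd, γ₁, hc, hs⟩ := h
  obtain ⟨hθ', -, hd', γ₂, hc', hs'⟩ := h'
  obtain rfl : ψ = ψ' := (hd 0).symm.trans (hd' 0)
  exact ⟨hs.phase_unique hm₁ hm₂ hV hψ hθ hθ' hs' (hc.symm.trans hc'), rfl⟩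

/-- Every phase and every separation at which the force is attractive is realised. -/
theorem exists_isSemisimpleRelEq {m₁ m₂ : ℝ} (hm₁ : 0 < m₁) (hm₂ : 0 < m₂) {V : ℝ → ℝ}
    (hV : DifferentiableOn ℝ V (Set.Ioi 1)) {θ ψ : ℝ} (hθ : θ ∈ Ico 0 Real.pi) (hψ : 0 < ψ)
    (hf : 0 < deriv V (Real.cosh ψ)) :
    ∃ γ, IsSemisimpleRelEq m₁ m₂ V γ ∧ IsStandardRelEq m₁ m₂ V θ ψ γ ∧
      HasPhaseSeparation m₁ m₂ V θ ψ γ := by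
  obtain ⟨⟨χ₁, χ₂⟩, ⟨h1, h2, h3, h4⟩, -⟩ := existsUnique_split hm₁ hm₂ hψ
  simp only at h1 h2 h3 h4
  have hsψ : 0 < Real.sinh ψ := Real.sinh_pos_iff.2 hψ
  have hs₁ : 0 < Real.sinh (2 * χ₁) := Real.sinh_pos_iff.2 (by linarith)
  set r := Real.sqrt (deriv V (Real.cosh ψ) * Real.sinh ψ / (2 * (m₁ * Real.sinh (2 * χ₁))))
    with hr_def
  have hr : 0 < r := Real.sqrt_pos.2 (by positivity)
  have hr2 : r ^ 2 = deriv V (Real.cosh ψ) * Real.sinh ψ / (2 * (m₁ * Real.sinh (2 * χ₁))) :=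
    Real.sq_sqrt (by positivity)
  set η : ℂ := r * (Complex.cos θ + Complex.sin θ * Complex.I) with hη_def
  have hnorm : ‖η‖ = r := by
    rw [hη_def, norm_mul, Complex.norm_cos_add_sin_mul_I, mul_one, Complex.norm_real,
      Real.norm_of_nonneg hr.le]
  have harg : η.arg = θ :=
    Complex.arg_mul_cos_add_sin_mul_I hr ⟨by linarith [Real.pi_pos, hθ.1], hθ.2.le⟩
  have hη : η ≠ 0 := norm_pos_iff.1 (hnorm ▸ hr)
  -- The momenta are those forced by `q̇ = -p/m`; the minus sign arises because the form is minus
  -- the metric.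
  let x : Ambient := ((splitExp χ₁, -m₁ • infConj (genS η) (splitExp χ₁)),
    (splitExp (-χ₂), -m₂ • infConj (genS η) (splitExp (-χ₂))))
  let γ : ℝ → Ambient := fun t => act (NormedSpace.exp (t • genS η)) x
  have hγ0 : γ 0 = x := by
    simp only [γ, zero_smul, NormedSpace.exp_zero, act_one]
  have hgen : GeneratedBy (genS η) γ := fun t => by rw [hγ0]
  have hform : form (splitExp χ₁) (splitExp (-χ₂)) = Real.cosh ψ := by rw [form_splitExp, h3]
  have horth (m χ : ℝ) : form (splitExp χ) (-m • infConj (genS η) (splitExp χ)) = 0 := by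
    have := form_infConj (trace_genS η) (splitExp χ) (splitExp χ)
    rw [form_comm] at this
    rw [form_smul_right]
    linear_combination (-m / 2) * this
  have hx : x ∈ phaseSpace := by
    refine ⟨⟨splitExp_mem_H3 _, isHermitian_real_smul (isHermitian_infConj _
      (splitExp_mem_H3 _).1) _, horth _ _⟩, ⟨splitExp_mem_H3 _, isHermitian_real_smul
      (isHermitian_infConj _ (splitExp_mem_H3 _).1) _, horth _ _⟩, fun h => ?_⟩
    have hone := form_self_of_mem_H3 (splitExp_mem_H3 χ₁)
    change splitExp χ₁ = splitExp (-χ₂) at h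
    rw [← h, hone] at hform
    exact (Real.one_lt_cosh.2 hψ.ne').ne hform
  have hA : 2 * m₁ * ‖η‖ ^ 2 * Real.sinh (2 * χ₁) =
      deriv V (Real.cosh ψ) * Real.sinh (χ₁ + χ₂) := by
    rw [hnorm, hr2, h3]
    field_simp
  have hB : 2 * m₂ * ‖η‖ ^ 2 * Real.sinh (2 * -χ₂) =
      deriv V (Real.cosh ψ) * Real.sinh (-χ₂ + -χ₁) := by
    rw [show 2 * -χ₂ = -(2 * χ₂) by ring, show -χ₂ + -χ₁ = -(χ₁ + χ₂) by ring, Real.sinh_neg,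
      Real.sinh_neg]
    linear_combination 2 * ‖η‖ ^ 2 * h4 - hA
  obtain ⟨c, hc⟩ := accel_splitExp_iff.2 hA
  obtain ⟨c', hc'⟩ := accel_splitExp_iff.2 hB
  rw [neg_neg] at hc'
  have heq : infAct (genS η) x = hamField m₁ m₂ V x := by
    have k (m : ℝ) (hm : 0 < m) (u : Biq) : u = -(1 / m) • -m • u := by
      rw [smul_smul, neg_mul_neg, one_div_mul_cancel hm.ne', one_smul]
    refine Prod.ext (Prod.ext (k _ hm₁ _) ?_) (Prod.ext (k _ hm₂ _) ?_)
    · refine (momentum_eq (trace_genS η) (form_self_of_mem_H3 (splitExp_mem_H3 _)) hc).trans ?_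
      simp only [hamField, x, hform]
    · refine (momentum_eq (trace_genS η) (form_self_of_mem_H3 (splitExp_mem_H3 _)) hc').trans ?_
      simp only [hamField, x, form_comm (splitExp (-χ₂)) (splitExp χ₁), hform]
  have hrel : IsRelEq m₁ m₂ V γ :=
    isRelEq_of_infAct_eq hV (det_exp_genS η) hgen (hγ0 ▸ hx) (hγ0 ▸ heq)
  have hstd : IsStandardRelEq m₁ m₂ V θ ψ γ :=
    ⟨hrel, η, χ₁, χ₂, hη, harg, hgen, h1, h2, h3, h4, by rw [hγ0], by rw [hγ0], by
      rw [hnorm, hr2]⟩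
  refine ⟨γ, ⟨hrel, genS η, genS_ne_zero hη, trace_genS η, isSemisimple_genS hη, hgen⟩, hstd, hθ,
    hψ, fun t => ?_, γ, ⟨1, fun t => by rw [Matrix.SpecialLinearGroup.coe_one, act_one]⟩, hstd⟩
  rw [hypDist, hrel.form_eq, hγ0]
  change Real.arcosh (form (splitExp χ₁) (splitExp (-χ₂))) = ψ
  rw [hform, Real.arcosh_cosh hψ.le]

end TwoBodyH3

theorem mainTheorem1 (m₁ m₂ : ℝ) (hm₁ : 0 < m₁) (hm₂ : 0 < m₂) (V : ℝ → ℝ)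
    (hV : DifferentiableOn ℝ V (Set.Ioi 1)) :
    -- every semisimple relative equilibrium is conjugate to one generated by `S = -iηI`
    (∀ γ, IsSemisimpleRelEq m₁ m₂ V γ →
      ∃ (η : ℂ) (γ' : ℝ → Ambient), η ≠ 0 ∧ Conjugate γ γ' ∧ IsRelEq m₁ m₂ V γ' ∧
        GeneratedBy (genS η) γ') ∧
    -- the separation determines `χ₁` and `χ₂`
    (∀ ψ : ℝ, 0 < ψ → ∃! χ : ℝ × ℝ, 0 < χ.1 ∧ 0 < χ.2 ∧ χ.1 + χ.2 = ψ ∧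
      m₁ * Real.sinh (2 * χ.1) = m₂ * Real.sinh (2 * χ.2)) ∧
    -- phase and separation are defined, and the force is attractive at that separation
    (∀ γ, IsSemisimpleRelEq m₁ m₂ V γ → deriv V (form (γ 0).1.1 (γ 0).2.1) ≠ 0 →
      0 < deriv V (form (γ 0).1.1 (γ 0).2.1) ∧
      ∃! P : ℝ × ℝ, HasPhaseSeparation m₁ m₂ V P.1 P.2 γ) ∧
    -- they form a complete invariant up to conjugacy
    (∀ γ γ', IsSemisimpleRelEq m₁ m₂ V γ → deriv V (form (γ 0).1.1 (γ 0).2.1) ≠ 0 →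
      IsSemisimpleRelEq m₁ m₂ V γ' → deriv V (form (γ' 0).1.1 (γ' 0).2.1) ≠ 0 →
      (Conjugate γ γ' ↔ ∃ θ ψ : ℝ, HasPhaseSeparation m₁ m₂ V θ ψ γ ∧
        HasPhaseSeparation m₁ m₂ V θ ψ γ')) ∧
    -- every phase and every separation occurs
    (∀ θ ∈ Set.Ico 0 Real.pi, ∀ ψ : ℝ, 0 < ψ → 0 < deriv V (Real.cosh ψ) →
      ∃ γ, IsSemisimpleRelEq m₁ m₂ V γ ∧ IsStandardRelEq m₁ m₂ V θ ψ γ ∧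
        HasPhaseSeparation m₁ m₂ V θ ψ γ) ∧
    -- no parabolic relative equilibria
    (StrictlyAttractive V → ∀ γ, ¬ IsParabolicRelEq m₁ m₂ V γ) := by
  refine ⟨fun γ hγ => exists_conjugate_generatedBy_genS hV hγ,
    fun ψ hψ => existsUnique_split hm₁ hm₂ hψ, fun γ hγ hf => ?_, fun γ γ' hγ hf hγ' hf' => ?_,
    fun θ hθ ψ hψ hf => exists_isSemisimpleRelEq hm₁ hm₂ hV hθ hψ hf,
    fun hatt γ => not_isParabolicRelEq hm₁ hm₂ hV hatt γ⟩
  · refine ⟨(exists_isStandardRelEq hm₁ hm₂ hV hγ hf).1, ?_⟩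
    obtain ⟨θ, ψ, h⟩ := exists_hasPhaseSeparation hm₁ hm₂ hV hγ hf
    refine ⟨(θ, ψ), h, fun P hP => ?_⟩
    obtain ⟨h1, h2⟩ := hP.unique hm₁ hm₂ hV h
    exact Prod.ext h1 h2
  · constructor
    · intro hc
      obtain ⟨θ, ψ, h⟩ := exists_hasPhaseSeparation hm₁ hm₂ hV hγ hf
      exact ⟨θ, ψ, h, h.of_conjugate hc⟩
    · rintro ⟨θ, ψ, ⟨-, hψ, -, γ₁, hc, hs⟩, -, -, -, γ₂, hc', hs'⟩
      -- Both motions are conjugate to one and the same standard motion.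
      rw [← hs.unique hm₁ hm₂ hV hψ hs'] at hc'
      exact hc.trans hc'.symm
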